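/- Let $N\ge 1$, let $a_1,\dots,a_{N-1}$ be nonzero real numbers, and put $$A=\sum_{j=1}^{\lfloor N/2\rfloor}a_{2j-1}E_{2j-1,2j}+\sum_{j=1}^{\lfloor (N-1)/2\rfloor}a_{2j}E_{2j+1,2j},\qquad T(x)=I+Ax,\qquad K=\sum_{j=1}^{\lfloor N/2\rfloor}E_{2j,2j},$$ where $E_{i,j}$ are the $N\times N$ matrix units. Consider the following weight matrices $W(x)=T(x)\,\mathrm{diag}(w_1(x),\dots,w_N(x))\,T(x)^*$ with real parameters: * (Hermite) $W_H$ on $(-\infty,\infty)$, with $w_j(x)=e^{-x^2+2b_jx}$, where $b_i\ne b_j$ for $i\neq j$; * (Laguerre) $W_L$ on $(0,\infty)$, with $w_j(x)=e^{-x}x^{\alpha_j}$, where $\alpha_j>-1$ and $\alpha_i-\alpha_j\notin\mathbb Z$ for $i\ne j$; * (Jacobi) $W_J$ on $(-1,1)$, with $w_j(x)=(1-x)^{\alpha_j}(1+x)^{\beta_j}$, where $\alpha_j,\beta_j>-1$, for all $i\neq j$ one has $\alpha_i-\alpha_j\notin\mathbb Z$ or $\beta_i-\beta_j\notin\mathbb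 Z$, and $\alpha_1+\beta_1=\alpha_j+\beta_j+1+(-1)^j$ for all $j=1,\dots,N$. Differential operators $D=\sum_{j=0}^m\partial^jF_j(x)$ with $F_j\in \mathrm{Mat}_N(\mathbb C[x])$ act on the right on $\mathrm{Mat}_N(\mathbb C[x])$ by $P\cdot D=\sum_j P^{(j)}(x)F_j(x)$, and are multiplied so that $P\cdot(D_1D_2)=(P\cdot D_1)\cdot D_2$. For a weight $W$ on an interval $(x_0,x_1)$, a sequence of orthogonal polynomials is a sequence $(P_n)_{n\ge0}$ in $\mathrm{Mat}_N(\mathbb C[x])$ such that $P_n$ has degree $n$ and nonsingular leading coefficient, and $\int_{x_0}^{x_1}P_n(x)W(x)P_m(x)^*dx=0$ for $n\ne m$. Let $\mathcal D(W)$ be the algebra of all such operators $D$ for which, for every $n\ge 0$, $P_n\cdot D=\Lambda_nP_n$ for some $\Lambda_n\in\mathrm{Mat}_N(\mathbb C)$; it does not depend on the choice of the sequence $(P_n)$. Put $[A,B]=AB-BA$ and $$B_H=\mathrm{diag}(2b_j),\qquad B_L=\mathrm{diag}(\alpha_j+1),\qquad B_J=\mathrm{diag}(\beta_j-\alpha_j),$$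 \begin{align*} D_H&=\partial^2I+\partial\big(2A+B_H-2xI+x[A,B_H]\big)+AB_H+2K,\\ D_L&=\partial^2xI+\partial\big(B_L-xI+2xA+x[A,B_L]\big)+AB_L+K,\\ D_J&=\partial^2(1-x^2)I+\partial\big(2A+B_J+x([A,B_J]+2K-(\alpha_1+\beta_1+2)I)\big)+AB_J+(\alpha_1+\beta_1)K. \end{align*} **Theorem.** Let $W$ be $W_H$, $W_L$ or $W_J$, and let $D$ be $D_H$, $D_L$ or $D_J$ respectively. Then $D\in\mathcal D(W)$, and $\mathcal D(W)$ is the polynomial algebra $\mathbb C[D]$: every element of $\mathcal D(W)$ is a polynomial in $D$ with complex coefficients, and $D$ is transcendental over $\mathbb C$. -/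

import Mathlib

open Polynomial

noncomputable section

namespace MatrixBochner

/-- `Mat_N(ℂ)`. Rows and columns are indexed from `0`: the index `i : Fin N` is the
index `i + 1` of the usual numbering `1, …, N`. -/
abbrev Mat (N : ℕ) := Matrix (Fin N) (Fin N) ℂ

/-- `Mat_N(ℂ[x])`: polynomials in `x` with coefficients in `Mat_N(ℂ)`. -/
abbrev MatPoly (N : ℕ) := (Mat N)[X]

/-- The value `P(x)` at a real point. -/
def evalAt {N : ℕ} (P : MatPoly N) (x : ℝ) : Mat N :=
  P.eval (Matrix.scalar (Fin N) (x : ℂ))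

/-! ### Right-acting differential operators -/

/-- Operators on `Mat_N(ℂ[x])` that act on the right and commute with multiplication by constant
matrices on the left. The opposite algebra is taken so that `P · (D₁ D₂) = (P · D₁) · D₂`. -/
abbrev RightOp (N : ℕ) := (Module.End (Mat N) (MatPoly N))ᵐᵒᵖ

/-- The right action `P · D`. -/
def act {N : ℕ} (P : MatPoly N) (D : RightOp N) : MatPoly N := D.unop P

/-- `∂ = d/dx`. -/
def del (N : ℕ) : RightOp N := MulOpposite.op derivative

/-- The operator of order zero `P ↦ P F`. -/
def coeffOp {N : ℕ} (F : MatPoly N) : RightOp N := MulOpposite.op (LinearMap.mulRight (Mat N) F)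

/-- The operator `∑ⱼ ∂ʲ Fⱼ(x)`, that is, `P ↦ ∑ⱼ P⁽ʲ⁾ Fⱼ`. -/
def diffOp {N : ℕ} (F : ℕ →₀ MatPoly N) : RightOp N :=
  F.sum fun j f => del N ^ j * coeffOp f

theorem act_one {N : ℕ} (P : MatPoly N) : act P 1 = P := rfl

theorem act_mul {N : ℕ} (P : MatPoly N) (D E : RightOp N) :
    act P (D * E) = act (act P D) E := rfl

theorem act_add {N : ℕ} (P : MatPoly N) (D E : RightOp N) :
    act P (D + E) = act P D + act P E := rfl

theorem act_smul_left {N : ℕ} (M : Mat N) (P : MatPoly N) (D : RightOp N) :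
    act (M • P) D = M • act P D := map_smul D.unop M P

theorem coeffOp_zero {N : ℕ} : coeffOp (0 : MatPoly N) = 0 := by
  apply MulOpposite.unop_injective; ext1; simp [coeffOp]

theorem coeffOp_one {N : ℕ} : coeffOp (1 : MatPoly N) = 1 := by
  apply MulOpposite.unop_injective
  refine LinearMap.ext fun P => ?_
  simp [coeffOp]

theorem coeffOp_add {N : ℕ} (F G : MatPoly N) : coeffOp (F + G) = coeffOp F + coeffOp G := by
  apply MulOpposite.unop_injective
  refine LinearMap.ext fun P => ?_
  simp [coeffOp, mul_add]

theorem coeffOp_mul {N : ℕ} (F G : MatPoly N) : coeffOp (F * G) = coeffOp F * coeffOp G := by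
  apply MulOpposite.unop_injective
  refine LinearMap.ext fun P => ?_
  simp [coeffOp, mul_assoc]

theorem coeffOp_mul_del {N : ℕ} (F : MatPoly N) :
    coeffOp F * del N = del N * coeffOp F + coeffOp (derivative F) := by
  apply MulOpposite.unop_injective
  refine LinearMap.ext fun P => ?_
  simp [coeffOp, del]

theorem coeffOp_algebraMap {N : ℕ} (c : ℂ) :
    coeffOp (algebraMap ℂ (MatPoly N) c) = algebraMap ℂ (RightOp N) c := by
  apply MulOpposite.unop_injective
  refine LinearMap.ext fun P => ?_
  change P * algebraMap ℂ (MatPoly N) c = c • P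
  rw [← Algebra.commutes, Algebra.smul_def]

theorem diffOp_single {N : ℕ} (j : ℕ) (f : MatPoly N) :
    diffOp (Finsupp.single j f) = del N ^ j * coeffOp f :=
  Finsupp.sum_single_index (by rw [coeffOp_zero, mul_zero])

theorem diffOp_zero {N : ℕ} : diffOp (0 : ℕ →₀ MatPoly N) = 0 := Finsupp.sum_zero_index

theorem diffOp_add {N : ℕ} (F G : ℕ →₀ MatPoly N) : diffOp (F + G) = diffOp F + diffOp G :=
  Finsupp.sum_add_index' (fun j => by rw [coeffOp_zero, mul_zero])
    (fun j f g => by rw [coeffOp_add, mul_add])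

theorem exists_diffOp_mul_coeffOp {N : ℕ} (F : ℕ →₀ MatPoly N) (g : MatPoly N) :
    ∃ H, diffOp F * coeffOp g = diffOp H := by
  induction F using Finsupp.induction_linear with
  | zero => exact ⟨0, by rw [diffOp_zero, zero_mul]⟩
  | add F G hF hG =>
    obtain ⟨H, hH⟩ := hF
    obtain ⟨L, hL⟩ := hG
    exact ⟨H + L, by rw [diffOp_add, add_mul, hH, hL, diffOp_add]⟩
  | single j f =>
    exact ⟨Finsupp.single j (f * g), by
      rw [diffOp_single, diffOp_single, coeffOp_mul, mul_assoc]⟩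

theorem exists_diffOp_mul_del {N : ℕ} (F : ℕ →₀ MatPoly N) :
    ∃ H, diffOp F * del N = diffOp H := by
  induction F using Finsupp.induction_linear with
  | zero => exact ⟨0, by rw [diffOp_zero, zero_mul]⟩
  | add F G hF hG =>
    obtain ⟨H, hH⟩ := hF
    obtain ⟨L, hL⟩ := hG
    exact ⟨H + L, by rw [diffOp_add, add_mul, hH, hL, diffOp_add]⟩
  | single j f =>
    exact ⟨Finsupp.single (j + 1) f + Finsupp.single j (derivative f), by
      rw [diffOp_add, diffOp_single, diffOp_single, diffOp_single, mul_assoc, coeffOp_mul_del,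
        mul_add, pow_succ, mul_assoc]⟩

theorem exists_diffOp_mul_del_pow {N : ℕ} (F : ℕ →₀ MatPoly N) (k : ℕ) :
    ∃ H, diffOp F * del N ^ k = diffOp H := by
  induction k with
  | zero => exact ⟨F, by rw [pow_zero, mul_one]⟩
  | succ k ih =>
    obtain ⟨H, hH⟩ := ih
    obtain ⟨L, hL⟩ := exists_diffOp_mul_del H
    exact ⟨L, by rw [pow_succ, ← mul_assoc, hH, hL]⟩

theorem exists_diffOp_mul {N : ℕ} (F G : ℕ →₀ MatPoly N) :
    ∃ H, diffOp F * diffOp G = diffOp H := by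
  induction G using Finsupp.induction_linear with
  | zero => exact ⟨0, by rw [diffOp_zero, mul_zero]⟩
  | add G G' hG hG' =>
    obtain ⟨H, hH⟩ := hG
    obtain ⟨L, hL⟩ := hG'
    exact ⟨H + L, by rw [diffOp_add, mul_add, hH, hL, diffOp_add]⟩
  | single k g =>
    obtain ⟨H, hH⟩ := exists_diffOp_mul_del_pow F k
    obtain ⟨L, hL⟩ := exists_diffOp_mul_coeffOp H g
    exact ⟨L, by rw [diffOp_single, ← mul_assoc, hH, hL]⟩

/-- `Mat_N(Ω[x])`: the algebra of all right-acting differential operators `∑ⱼ ∂ʲ Fⱼ(x)` with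
coefficients `Fⱼ ∈ Mat_N(ℂ[x])`. (The coefficients of such an operator are determined by its action
on `Mat_N(ℂ[x])`, see `diffOp_injective`.) -/
def matDiffOps (N : ℕ) : Subalgebra ℂ (RightOp N) where
  carrier := {D | ∃ F : ℕ →₀ MatPoly N, D = diffOp F}
  mul_mem' := by
    rintro _ _ ⟨F, rfl⟩ ⟨G, rfl⟩
    exact exists_diffOp_mul F G
  add_mem' := by
    rintro _ _ ⟨F, rfl⟩ ⟨G, rfl⟩
    exact ⟨F + G, (diffOp_add F G).symm⟩
  algebraMap_mem' := fun c =>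
    ⟨Finsupp.single 0 (algebraMap ℂ (MatPoly N) c), by
      rw [diffOp_single, pow_zero, one_mul, coeffOp_algebraMap]⟩

theorem act_diffOp {N : ℕ} (F : ℕ →₀ MatPoly N) (P : MatPoly N) :
    act P (diffOp F) = F.sum fun j f => derivative^[j] P * f := by
  induction F using Finsupp.induction_linear with
  | zero => simp [diffOp_zero, act]
  | add F G hF hG =>
    rw [diffOp_add, act_add, hF, hG, Finsupp.sum_add_index' (by simp) (by simp [mul_add])]
  | single j f =>
    rw [diffOp_single, Finsupp.sum_single_index (by simp)]
    simp [act, del, coeffOp, Module.End.pow_apply]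

theorem iterate_derivative_X_pow_mat {N : ℕ} (n k : ℕ) :
    derivative^[k] (X ^ n : MatPoly N) = (Nat.descFactorial n k) • X ^ (n - k) := by
  induction k with
  | zero => simp
  | succ k ih =>
    rw [Function.iterate_succ_apply', ih, map_nsmul, derivative_X_pow, Nat.descFactorial_succ,
      Nat.sub_sub, C_eq_natCast, ← nsmul_eq_mul, ← mul_nsmul]

theorem diffOp_injective {N : ℕ} :
    Function.Injective (diffOp : (ℕ →₀ MatPoly N) → RightOp N) := by
  intro F G hFG
  ext1 k
  induction k using Nat.strong_induction_on with
  | _ k ih =>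
    have h : act (X ^ k) (diffOp F) = act (X ^ k) (diffOp G) := by rw [hFG]
    have key : ∀ H : ℕ →₀ MatPoly N, act (X ^ k) (diffOp H) =
        ∑ j ∈ Finset.range (k + 1), derivative^[j] (X ^ k : MatPoly N) * H j := by
      intro H
      rw [act_diffOp]
      rw [Finsupp.sum_of_support_subset H (s := H.support ∪ Finset.range (k + 1))
        Finset.subset_union_left _ (by simp)]
      symm
      apply Finset.sum_subset Finset.subset_union_right
      intro j _ hj
      rw [Finset.mem_range, not_lt] at hj
      rw [iterate_derivative_X_pow_mat, Nat.descFactorial_of_lt (by omega)]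
      simp
    rw [key, key, Finset.sum_range_succ, Finset.sum_range_succ,
      Finset.sum_congr rfl (fun j hj => by rw [ih j (Finset.mem_range.mp hj)])] at h
    have h2 := add_left_cancel h
    rw [iterate_derivative_X_pow_mat, Nat.sub_self, pow_zero, Nat.descFactorial_self,
      smul_mul_assoc, smul_mul_assoc, one_mul, one_mul] at h2
    have h3 : ((k.factorial : ℂ)) • F k = ((k.factorial : ℂ)) • G k := by
      rw [Nat.cast_smul_eq_nsmul, Nat.cast_smul_eq_nsmul]; exact h2
    exact smul_right_injective _ (Nat.cast_ne_zero.mpr k.factorial_ne_zero) h3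

/-! ### Matrix weights, orthogonal polynomials, and the algebra `𝒟(W)` -/

/-- `⟨P, Q⟩ = ∫_S P(x) W(x) Q(x)* dx`, the integral being taken entry by entry. -/
def matInner {N : ℕ} (S : Set ℝ) (W : ℝ → Mat N) (P Q : MatPoly N) : Mat N :=
  fun i j => ∫ x in S, (evalAt P x * W x * (evalAt Q x).conjTranspose) i j

/-- `(Pₙ)` is a sequence of matrix-valued orthogonal polynomials for the weight `W` on `S`:
`Pₙ` has degree `n` and nonsingular leading coefficient, and `⟨Pₙ, Pₘ⟩ = 0` for `n ≠ m`. -/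
structure IsOrthogonalSeq {N : ℕ} (S : Set ℝ) (W : ℝ → Mat N) (P : ℕ → MatPoly N) : Prop where
  natDegree_eq : ∀ n, (P n).natDegree = n
  isUnit_leadingCoeff : ∀ n, IsUnit (P n).leadingCoeff
  orthogonal : ∀ n m, n ≠ m → matInner S W (P n) (P m) = 0

/-- The algebra `𝒟(W)` of all `D ∈ Mat_N(Ω[x])` such that, for each `n`,
`Pₙ · D = Λₙ Pₙ` with a constant matrix `Λₙ`. This does not depend on the sequence `(Pₙ)` of
orthogonal polynomials for `W`; it is required here for all of them. -/
def weightAlgebra {N : ℕ} (S : Set ℝ) (W : ℝ → Mat N) : Subalgebra ℂ (RightOp N) where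
  carrier := {D | D ∈ matDiffOps N ∧
    ∀ P : ℕ → MatPoly N, IsOrthogonalSeq S W P → ∀ n, ∃ L : Mat N, act (P n) D = C L * P n}
  mul_mem' := by
    rintro D E ⟨hD, hD'⟩ ⟨hE, hE'⟩
    refine ⟨mul_mem hD hE, fun P hP n => ?_⟩
    obtain ⟨L, hL⟩ := hD' P hP n
    obtain ⟨M, hM⟩ := hE' P hP n
    refine ⟨L * M, ?_⟩
    rw [act_mul, hL, ← smul_eq_C_mul, act_smul_left, hM, smul_eq_C_mul, C_mul, mul_assoc]
  add_mem' := by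
    rintro D E ⟨hD, hD'⟩ ⟨hE, hE'⟩
    refine ⟨add_mem hD hE, fun P hP n => ?_⟩
    obtain ⟨L, hL⟩ := hD' P hP n
    obtain ⟨M, hM⟩ := hE' P hP n
    exact ⟨L + M, by rw [act_add, hL, hM, C_add, add_mul]⟩
  algebraMap_mem' := fun c => by
    refine ⟨Subalgebra.algebraMap_mem _ c, fun P _ n => ⟨algebraMap ℂ (Mat N) c, ?_⟩⟩
    change c • P n = _
    rw [Algebra.smul_def]
    rfl

/-! ### The three families of weights -/

/-- `A = ∑_{j=1}^{[N/2]} a_{2j-1} E_{2j-1,2j} + ∑_{j=1}^{[(N-1)/2]} a_{2j} E_{2j+1,2j}`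
in the usual numbering from `1`; only `a 1, …, a (N - 1)` occur. -/
def matA (N : ℕ) (a : ℕ → ℝ) : Mat N := fun i k =>
  if Even i.val ∧ k.val = i.val + 1 then (a (i.val + 1) : ℂ)
  else if Even i.val ∧ i.val = k.val + 1 then (a i.val : ℂ)
  else 0

/-- `K = ∑_{j=1}^{[N/2]} E_{2j,2j}` in the usual numbering from `1`. -/
def matK (N : ℕ) : Mat N := Matrix.diagonal fun i => if Odd i.val then 1 else 0

/-- `W(x) = T(x) diag(w₁(x), …, w_N(x)) T(x)*` with `T(x) = I + A x`. -/
def twistedWeight {N : ℕ} (a : ℕ → ℝ) (w : Fin N → ℝ → ℝ) (x : ℝ) : Mat N :=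
  (1 + (x : ℂ) • matA N a) * Matrix.diagonal (fun i => (w i x : ℂ)) *
    (1 + (x : ℂ) • matA N a).conjTranspose

/-- `W_H`, on `(-∞, ∞)`, from the scalar weights `exp (-x² + 2 bⱼ x)`. -/
def weightH {N : ℕ} (a : ℕ → ℝ) (b : Fin N → ℝ) : ℝ → Mat N :=
  twistedWeight a fun i x => Real.exp (-x ^ 2 + 2 * b i * x)

/-- `W_L`, on `(0, ∞)`, from the scalar weights `exp (-x) x ^ αⱼ`. -/
def weightL {N : ℕ} (a : ℕ → ℝ) (α : Fin N → ℝ) : ℝ → Mat N :=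
  twistedWeight a fun i x => Real.exp (-x) * x ^ α i

/-- `W_J`, on `(-1, 1)`, from the scalar weights `(1 - x) ^ αⱼ (1 + x) ^ βⱼ`. -/
def weightJ {N : ℕ} (a : ℕ → ℝ) (α β : Fin N → ℝ) : ℝ → Mat N :=
  twistedWeight a fun i x => (1 - x) ^ α i * (1 + x) ^ β i

/-! ### The second-order operators -/

/-- `B_H = ∑ 2 bⱼ Eⱼⱼ`. -/
def matBH {N : ℕ} (b : Fin N → ℝ) : Mat N := Matrix.diagonal fun i => 2 * (b i : ℂ)

/-- `B_L = ∑ (αⱼ + 1) Eⱼⱼ`. -/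
def matBL {N : ℕ} (α : Fin N → ℝ) : Mat N := Matrix.diagonal fun i => (α i : ℂ) + 1

/-- `B_J = ∑ (βⱼ - αⱼ) Eⱼⱼ`. -/
def matBJ {N : ℕ} (α β : Fin N → ℝ) : Mat N := Matrix.diagonal fun i => (β i : ℂ) - (α i : ℂ)

/-- `[A, B] = A B - B A`. -/
def comm {N : ℕ} (A B : Mat N) : Mat N := A * B - B * A

/-- `D_H = ∂² I + ∂ (2A + B_H - 2x + x [A, B_H]) + A B_H + 2K`. -/
def opH {N : ℕ} (a : ℕ → ℝ) (b : Fin N → ℝ) : RightOp N :=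
  del N ^ 2
    + del N * coeffOp (C (2 * matA N a + matBH b) - 2 * X + X * C (comm (matA N a) (matBH b)))
    + coeffOp (C (matA N a * matBH b + 2 * matK N))

/-- `D_L = ∂² x I + ∂ (B_L - x + 2x A + x [A, B_L]) + A B_L + K`. -/
def opL {N : ℕ} (a : ℕ → ℝ) (α : Fin N → ℝ) : RightOp N :=
  del N ^ 2 * coeffOp X
    + del N * coeffOp
        (C (matBL α) - X + X * C (2 * matA N a) + X * C (comm (matA N a) (matBL α)))
    + coeffOp (C (matA N a * matBL α + matK N))

/-- `D_J = ∂² (1 - x²) I + ∂ (2A + B_J + x ([A, B_J] + 2K - (α₁ + β₁ + 2) I)) + A B_J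
+ (α₁ + β₁) K`; the first parameters `α₁, β₁` are `α 0, β 0`. -/
def opJ {N : ℕ} [NeZero N] (a : ℕ → ℝ) (α β : Fin N → ℝ) : RightOp N :=
  del N ^ 2 * coeffOp (1 - X ^ 2)
    + del N * coeffOp
        (C (2 * matA N a + matBJ α β)
          + X * C (comm (matA N a) (matBJ α β) + 2 * matK N
              - ((α 0 : ℂ) + (β 0 : ℂ) + 2) • (1 : Mat N)))
    + coeffOp (C (matA N a * matBJ α β + ((α 0 : ℂ) + (β 0 : ℂ)) • matK N))

/-- The algebra `𝒜` is the polynomial algebra `ℂ[D]`: it consists of the polynomials in `D` with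
complex coefficients, and `D` satisfies no nontrivial polynomial equation. -/
def IsPolynomialAlgebraIn {R : Type*} [Ring R] [Algebra ℂ R] (𝒜 : Subalgebra ℂ R) (D : R) : Prop :=
  D ∈ 𝒜 ∧ 𝒜 = Algebra.adjoin ℂ {D} ∧ Transcendental ℂ D

end MatrixBochner

end

noncomputable section

namespace MatrixBochner

/-! ### The action on polynomial row vectors -/

/-! Since `A * A = 0`, the twist `T = 1 + A x` is invertible over the polynomials, and conjugating
by it replaces `W` by the diagonal weight `diag(w_i)`. An element `D` of the algebra preserves
degrees and has an adjoint for `W` (`hat_mem_degLT_and_exists_adjoint`), so the entry `E_ij` of its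
conjugate is a scalar differential operator with an adjoint going from `w_j` to `w_i`. Integration
by parts against `w_j` alone gives a second adjoint. If `i ≠ j` and `E_ij ≠ 0`, comparing the two
would make `w_j / w_i` rational, which the parameters exclude. Hence the conjugate is diagonal
(`entry_conjOp_eq_zero`).

Each diagonal entry preserves degrees, and so does its adjoint; thus the orthogonal polynomials of
`w_i` are eigenfunctions, with an eigenvalue `e_i(n)` polynomial in `n`. Since `D` itself, before
conjugation, preserves degrees, `e_k(n + 1) = e_i(n)` whenever `A i k ≠ 0` (`coeff_entry_succ`).
Neighbouring indices are linked by nonzero entries of `A`, so `e_0 = 0` forces `D = 0`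
(`eq_zero_of_entry_zero`).

The given second-order operator `D₀` is conjugate to a diagonal of classical operators, which are
symmetric by the Pearson equations, so it lies in the algebra. Its eigenvalues `l n` at index `0`
are distinct, which gives transcendence. It remains to write `e_0(n)` as a polynomial `P` in `l n`;
then `D - P(D₀)` vanishes at index `0`, so `D = P(D₀)`. For Hermite and Laguerre `l` is affine in
`n` and nothing is left to prove. For Jacobi it is quadratic, and `P` comes from evaluating at the
endpoint `-1` (`exists_eval_eigenvalue_of_jacobi`). -/

/-- Row vectors with polynomial entries. -/
abbrev Row (N : ℕ) := Fin N → ℂ[X]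

/-- The `r`-th row of a matrix polynomial. -/
def rowOf {N : ℕ} (r : Fin N) : MatPoly N →ₗ[ℂ] Row N where
  toFun P := matPolyEquiv.symm P r
  map_add' P Q := by rw [map_add]; rfl
  map_smul' c P := by
    ext j n
    simp [matPolyEquiv_symm_apply_coeff]

theorem coeff_rowOf {N : ℕ} (r j : Fin N) (P : MatPoly N) (n : ℕ) :
    (rowOf r P j).coeff n = P.coeff n r j :=
  matPolyEquiv_symm_apply_coeff P r j n

theorem ext_rowOf {N : ℕ} {P Q : MatPoly N} (h : ∀ r, rowOf r P = rowOf r Q) : P = Q := by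
  ext n i j
  rw [← coeff_rowOf, ← coeff_rowOf, h]

theorem rowOf_mul {N : ℕ} (r : Fin N) (P F : MatPoly N) (j : Fin N) :
    rowOf r (P * F) j = ∑ i, rowOf r P i * rowOf i F j := by
  change matPolyEquiv.symm (P * F) r j = _
  rw [map_mul, Matrix.mul_apply]
  rfl

theorem rowOf_C_mul {N : ℕ} (r : Fin N) (L : Mat N) (P : MatPoly N) :
    rowOf r (C L * P) = ∑ s, L r s • rowOf s P := by
  ext j n
  rw [coeff_rowOf, coeff_C_mul, Matrix.mul_apply]
  simp [coeff_rowOf, Finset.sum_apply]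

theorem rowOf_derivative {N : ℕ} (r j : Fin N) (P : MatPoly N) :
    rowOf r (derivative P) j = derivative (rowOf r P j) := by
  ext n
  rw [coeff_rowOf, coeff_derivative, coeff_derivative, coeff_rowOf]
  have : ((n : Mat N) + 1) = ((n : ℂ) + 1) • (1 : Mat N) := by
    rw [add_smul, one_smul, Nat.cast_smul_eq_nsmul, nsmul_eq_mul, mul_one]
  rw [this, mul_smul_comm, mul_one, Matrix.smul_apply, smul_eq_mul, mul_comm]

theorem act_C_mul {N : ℕ} (L : Mat N) (P : MatPoly N) (D : RightOp N) :
    act (C L * P) D = C L * act P D := by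
  rw [← smul_eq_C_mul, act_smul_left, smul_eq_C_mul]

theorem act_add_left {N : ℕ} (P Q : MatPoly N) (D : RightOp N) :
    act (P + Q) D = act P D + act Q D := map_add D.unop P Q

theorem act_complex_smul {N : ℕ} (c : ℂ) (P : MatPoly N) (D : RightOp N) :
    act (c • P) D = c • act P D := by
  have h : ∀ Q : MatPoly N, c • Q = C (c • (1 : Mat N)) * Q := fun Q => by
    rw [← smul_eq_C_mul, smul_assoc, one_smul]
  rw [h, act_C_mul, ← h]

section hat
variable {N : ℕ} [NeZero N]

/-- The matrix polynomial with first row `v` and all other rows zero. -/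
def ofRow : Row N →ₗ[ℂ] MatPoly N where
  toFun v := matPolyEquiv (Matrix.of fun i j => if i = 0 then v j else 0)
  map_add' v w := by
    ext n i j
    simp only [coeff_add, Matrix.add_apply, matPolyEquiv_coeff_apply, Matrix.of_apply]
    split_ifs <;> simp
  map_smul' c v := by
    ext n i j
    simp only [coeff_smul, Matrix.smul_apply, matPolyEquiv_coeff_apply, Matrix.of_apply,
      RingHom.id_apply]
    split_ifs <;> simp

theorem rowOf_zero_ofRow (v : Row N) : rowOf 0 (ofRow v) = v := by
  ext j n
  rw [coeff_rowOf]
  simp [ofRow, matPolyEquiv_coeff_apply]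

theorem ofRow_rowOf (r : Fin N) (P : MatPoly N) :
    ofRow (rowOf r P) = C (Matrix.single 0 r 1) * P := by
  refine ext_rowOf fun s => ?_
  rw [rowOf_C_mul]
  ext j n
  rw [coeff_rowOf]
  by_cases h : s = 0
  · subst h
    rw [Finset.sum_eq_single r (fun b _ hb => by
      rw [Matrix.single_apply_of_col_ne _ _ hb.symm, zero_smul]) (by simp)]
    simp [ofRow, matPolyEquiv_coeff_apply, coeff_rowOf]
  · have h' : ¬ (0 = s) := fun e => h e.symm
    simp [ofRow, matPolyEquiv_coeff_apply, h, h']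

/-- The action of a right operator on row vectors. -/
def hat (D : RightOp N) : Row N →ₗ[ℂ] Row N where
  toFun v := rowOf 0 (act (ofRow v) D)
  map_add' v w := by rw [map_add, act_add_left, map_add]
  map_smul' c v := by rw [map_smul, act_complex_smul, map_smul]; rfl

/-- A right operator commutes with left multiplication by matrix units, so it acts on every row by
one and the same map; this reduces matrix polynomials to row vectors. -/
theorem rowOf_act (r : Fin N) (P : MatPoly N) (D : RightOp N) :
    rowOf r (act P D) = hat D (rowOf r P) := by
  change _ = rowOf 0 (act (ofRow (rowOf r P)) D)
  rw [ofRow_rowOf, act_C_mul, rowOf_C_mul]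
  simp [Matrix.single_apply, ite_smul]

theorem hat_mul (D E : RightOp N) (v : Row N) : hat (D * E) v = hat E (hat D v) := by
  conv_lhs => rw [← rowOf_zero_ofRow v]
  rw [← rowOf_act, act_mul, rowOf_act, rowOf_act, rowOf_zero_ofRow]

theorem hat_one (v : Row N) : hat (1 : RightOp N) v = v := by
  conv_lhs => rw [← rowOf_zero_ofRow v]
  rw [← rowOf_act, act_one, rowOf_zero_ofRow]

theorem hat_add (D E : RightOp N) (v : Row N) : hat (D + E) v = hat D v + hat E v := by
  change rowOf 0 (act (ofRow v) (D + E)) = _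
  rw [act_add, map_add]; rfl

theorem hat_zero (v : Row N) : hat (0 : RightOp N) v = 0 := by
  have := hat_add (0 : RightOp N) 0 v
  rwa [add_zero, left_eq_add] at this

theorem hat_algebraMap (c : ℂ) (v : Row N) : hat (algebraMap ℂ (RightOp N) c) v = c • v := by
  change rowOf 0 (c • ofRow v) = _
  rw [map_smul, rowOf_zero_ofRow]

theorem eq_zero_of_hat {D : RightOp N} (h : ∀ v, hat D v = 0) : D = 0 := by
  apply MulOpposite.unop_injective
  refine LinearMap.ext fun P => ext_rowOf fun r => ?_
  have := rowOf_act r P D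
  rw [h] at this
  exact this.trans (map_zero (rowOf r)).symm

theorem hat_del (v : Row N) (j : Fin N) : hat (del N) v j = derivative (v j) := by
  conv_lhs => rw [← rowOf_zero_ofRow v]
  rw [← rowOf_act]
  change rowOf 0 (derivative (ofRow v)) j = _
  rw [rowOf_derivative, rowOf_zero_ofRow]

theorem hat_del_pow (k : ℕ) (v : Row N) (j : Fin N) :
    hat (del N ^ k) v j = derivative^[k] (v j) := by
  induction k generalizing v with
  | zero => rw [pow_zero, hat_one]; rfl
  | succ k ih => rw [pow_succ', hat_mul, ih, Function.iterate_succ_apply, hat_del]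

theorem hat_coeffOp (F : MatPoly N) (v : Row N) (j : Fin N) :
    hat (coeffOp F) v j = ∑ i, v i * rowOf i F j := by
  conv_lhs => rw [← rowOf_zero_ofRow v]
  rw [← rowOf_act]
  change rowOf 0 (ofRow v * F) j = _
  rw [rowOf_mul, rowOf_zero_ofRow]

theorem hat_diffOp (F : ℕ →₀ MatPoly N) (v : Row N) (j : Fin N) :
    hat (diffOp F) v j = F.sum fun k f => ∑ i, derivative^[k] (v i) * rowOf i f j := by
  induction F using Finsupp.induction_linear with
  | zero => rw [diffOp_zero, hat_zero, Finsupp.sum_zero_index]; rfl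
  | add F G hF hG =>
    rw [diffOp_add, hat_add, Pi.add_apply, hF, hG, Finsupp.sum_add_index' (by simp)]
    simp [mul_add, Finset.sum_add_distrib]
  | single k f =>
    rw [diffOp_single, hat_mul, hat_coeffOp, Finsupp.sum_single_index (by simp)]
    simp only [hat_del_pow]

theorem hat_aeval {D : RightOp N} {v : Row N} {c : ℂ} (h : hat D v = c • v) (p : ℂ[X]) :
    hat (aeval D p) v = p.eval c • v := by
  induction p using Polynomial.induction_on' with
  | add p q hp hq => rw [map_add, hat_add, hp, hq, eval_add, add_smul]
  | monomial n b =>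
    rw [aeval_monomial, hat_mul, hat_algebraMap, eval_monomial]
    have : ∀ k, hat (D ^ k) v = c ^ k • v := fun k => by
      induction k with
      | zero => rw [pow_zero, hat_one, pow_zero, one_smul]
      | succ k ih => rw [pow_succ, hat_mul, ih, map_smul, h, smul_smul, pow_succ]
    rw [map_smul, this, smul_smul]

end hat

/-! ### The degree filtration -/

/-- Row vectors with entries of degree less than `n`. -/
def degLT (N n : ℕ) : Submodule ℂ (Row N) := Submodule.pi Set.univ fun _ => degreeLT ℂ n

theorem mem_degLT {N n : ℕ} {v : Row N} : v ∈ degLT N n ↔ ∀ i, v i ∈ degreeLT ℂ n := by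
  simp [degLT, Submodule.mem_pi]

theorem mem_degreeLT_iff_coeff {n : ℕ} {p : ℂ[X]} :
    p ∈ degreeLT ℂ n ↔ ∀ m, n ≤ m → p.coeff m = 0 := by
  rw [mem_degreeLT, degree_lt_iff_coeff_zero]

theorem mem_degLT_iff_coeff {N n : ℕ} {v : Row N} :
    v ∈ degLT N n ↔ ∀ i m, n ≤ m → (v i).coeff m = 0 := by
  simp only [mem_degLT, mem_degreeLT_iff_coeff]

theorem degLT_mono {N m n : ℕ} (h : m ≤ n) : degLT N m ≤ degLT N n := fun v hv => by
  rw [mem_degLT_iff_coeff] at hv ⊢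
  exact fun i k hk => hv i k (h.trans hk)

theorem exists_mem_degLT {N : ℕ} (v : Row N) : ∃ n, v ∈ degLT N n := by
  refine ⟨Finset.univ.sup (fun i => (v i).natDegree) + 1, mem_degLT_iff_coeff.2 fun i m hm => ?_⟩
  apply coeff_eq_zero_of_natDegree_lt
  have := Finset.le_sup (f := fun i => (v i).natDegree) (Finset.mem_univ i)
  omega

instance {N n : ℕ} : FiniteDimensional ℂ (degLT N n) := by
  let f : degLT N n →ₗ[ℂ] (Fin N → Fin n → ℂ) :=
    { toFun := fun v i m => (v.1 i).coeff m
      map_add' := fun v w => by ext; simp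
      map_smul' := fun c v => by ext; simp }
  refine Module.Finite.of_injective f fun v w h => ?_
  ext i m
  by_cases hm : m < n
  · exact congr_fun (congr_fun h i) ⟨m, hm⟩
  · rw [mem_degLT_iff_coeff.1 v.2 i m (not_lt.1 hm), mem_degLT_iff_coeff.1 w.2 i m (not_lt.1 hm)]

theorem rowOf_mem_degLT {N n : ℕ} {P : MatPoly N} (h : P.natDegree ≤ n) (r : Fin N) :
    rowOf r P ∈ degLT N (n + 1) := by
  refine mem_degLT_iff_coeff.2 fun i m hm => ?_
  rw [coeff_rowOf, coeff_eq_zero_of_natDegree_lt (by omega)]; rfl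

/-- The rows of an invertible leading coefficient form a basis of `ℂ^N`, so some combination of the
rows of `P` cancels the degree-`n` part of `v`. -/
theorem exists_sub_sum_rowOf_mem {N n : ℕ} {P : MatPoly N} (h : P.natDegree = n)
    (hu : IsUnit P.leadingCoeff) {v : Row N} (hv : v ∈ degLT N (n + 1)) :
    ∃ c : Fin N → ℂ, v - ∑ r, c r • rowOf r P ∈ degLT N n := by
  obtain ⟨u, hu⟩ := hu
  refine ⟨Matrix.vecMul (fun i => (v i).coeff n) (u⁻¹).1, mem_degLT_iff_coeff.2 fun i m hm => ?_⟩
  rcases hm.eq_or_lt with rfl | hm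
  · have h1 : Matrix.vecMul (Matrix.vecMul (fun i => (v i).coeff n) (u⁻¹).1) u.1 i
        = (v i).coeff n := by
      rw [Matrix.vecMul_vecMul, Units.inv_mul, Matrix.vecMul_one]
    rw [hu, leadingCoeff, h] at h1
    rw [Pi.sub_apply, coeff_sub, ← h1, Finset.sum_apply, finsetSum_coeff]
    simp only [Pi.smul_apply, coeff_smul, coeff_rowOf, smul_eq_mul]
    exact sub_self _
  · rw [Pi.sub_apply, coeff_sub, mem_degLT_iff_coeff.1 hv i m hm, Finset.sum_apply,
      finsetSum_coeff]
    simp only [Pi.smul_apply, coeff_smul, coeff_rowOf]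
    rw [coeff_eq_zero_of_natDegree_lt (h ▸ hm)]
    simp

/-- Serves as an induction principle: a linear property of row vectors need only be checked on the
rows of the `P k`. -/
theorem degLT_le_of_rowOf_mem {N : ℕ} {P : ℕ → MatPoly N} (h : ∀ n, (P n).natDegree = n)
    (hu : ∀ n, IsUnit (P n).leadingCoeff) (S : Submodule ℂ (Row N)) (n : ℕ)
    (hS : ∀ k < n, ∀ r, rowOf r (P k) ∈ S) : degLT N n ≤ S := by
  induction n with
  | zero =>
    intro v hv
    have : v = 0 := by
      ext i m
      exact mem_degLT_iff_coeff.1 hv i m (Nat.zero_le _)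
    rw [this]; exact S.zero_mem
  | succ n ih =>
    intro v hv
    obtain ⟨c, hc⟩ := exists_sub_sum_rowOf_mem (h n) (hu n) hv
    have h1 := ih (fun k hk => hS k (by omega)) hc
    have h2 : ∑ r, c r • rowOf r (P n) ∈ S :=
      S.sum_mem fun r _ => S.smul_mem _ (hS n (by omega) r)
    simpa using S.add_mem h1 h2

/-! ### Moment functionals and the associated bilinear forms -/

/-- Complex conjugation of the coefficients. -/
def conjPoly : ℂ[X] →+* ℂ[X] := mapRingHom (starRingEnd ℂ)

theorem coeff_conjPoly (p : ℂ[X]) (n : ℕ) : (conjPoly p).coeff n = starRingEnd ℂ (p.coeff n) := by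
  simp [conjPoly]

theorem conjPoly_conjPoly (p : ℂ[X]) : conjPoly (conjPoly p) = p := by
  ext n
  simp [coeff_conjPoly]

/-- A linear functional on polynomials that behaves like integration against a positive weight
on the real line. -/
structure IsPositiveMoment (u : ℂ[X] →ₗ[ℂ] ℂ) : Prop where
  conj : ∀ p, u (conjPoly p) = starRingEnd ℂ (u p)
  pos : ∀ p, p ≠ 0 → 0 < (u (p * conjPoly p)).re

theorem IsPositiveMoment.eq_zero {u : ℂ[X] →ₗ[ℂ] ℂ} (hu : IsPositiveMoment u) {h : ℂ[X]}
    (hh : u (h * conjPoly h) = 0) : h = 0 := by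
  by_contra h0
  have := hu.pos h h0
  rw [hh] at this
  exact lt_irrefl _ this

/-- Riesz representation in finite dimension: nondegeneracy makes `W` inject into its dual, and
equality of dimensions gives surjectivity. -/
theorem exists_represent {V : Type*} [AddCommGroup V] [Module ℂ V] (B : V →ₗ[ℂ] V →ₗ[ℂ] ℂ)
    (W : Submodule ℂ V) [FiniteDimensional ℂ W]
    (hB : ∀ w ∈ W, (∀ v ∈ W, B v w = 0) → w = 0) (f : V →ₗ[ℂ] ℂ) :
    ∃ w ∈ W, ∀ v ∈ W, f v = B v w := by
  let g : W →ₗ[ℂ] Module.Dual ℂ W :=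
    { toFun := fun w => (B.flip w.1).comp W.subtype
      map_add' := fun x y => by ext; simp
      map_smul' := fun c x => by ext; simp }
  have hg : Function.Injective g := by
    rw [← LinearMap.ker_eq_bot, LinearMap.ker_eq_bot']
    intro w hw
    ext
    exact hB w.1 w.2 fun v hv => LinearMap.congr_fun hw ⟨v, hv⟩
  have hs : Function.Surjective g :=
    (LinearMap.injective_iff_surjective_of_finrank_eq_finrank
      (Subspace.dual_finrank_eq).symm).1 hg
  obtain ⟨w, hw⟩ := hs (f.comp W.subtype)
  exact ⟨w.1, w.2, fun v hv => (LinearMap.congr_fun hw ⟨v, hv⟩).symm⟩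

theorem conjPoly_mem_degreeLT {n : ℕ} {p : ℂ[X]} (h : p ∈ degreeLT ℂ n) :
    conjPoly p ∈ degreeLT ℂ n := by
  rw [mem_degreeLT_iff_coeff] at h ⊢
  intro m hm
  rw [coeff_conjPoly, h m hm, map_zero]

/-- Coefficientwise conjugation of row vectors. -/
def conjRow {N : ℕ} (v : Row N) : Row N := fun i => conjPoly (v i)

theorem conjRow_conjRow {N : ℕ} (v : Row N) : conjRow (conjRow v) = v :=
  funext fun i => conjPoly_conjPoly (v i)

theorem conjRow_mem_degLT {N n : ℕ} {v : Row N} (h : v ∈ degLT N n) :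
    conjRow v ∈ degLT N n := by
  rw [mem_degLT] at h ⊢
  exact fun i => conjPoly_mem_degreeLT (h i)

theorem conjRow_add {N : ℕ} (v w : Row N) : conjRow (v + w) = conjRow v + conjRow w :=
  funext fun i => map_add conjPoly (v i) (w i)

theorem conjRow_smul {N : ℕ} (c : ℂ) (v : Row N) :
    conjRow (c • v) = starRingEnd ℂ c • conjRow v := by
  ext i m
  simp [conjRow, coeff_conjPoly]

/-! ### The twist by `T(x) = 1 + A x` -/

/-- `T(x) = 1 + A x`. -/
def twist {N : ℕ} (A : Mat N) : MatPoly N := 1 + C A * X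

theorem twist_mul_twist_neg {N : ℕ} {A : Mat N} (hA : A * A = 0) :
    twist A * twist (-A) = 1 := by
  have h : ∀ B : Mat N, A * B = 0 → (C A * X * (C B * X) : MatPoly N) = 0 := fun B hB => by
    rw [mul_assoc, ← mul_assoc X, X_mul, mul_assoc, ← mul_assoc (C A), ← C_mul, hB, C_0, zero_mul]
  have h1 : A * -A = 0 := by rw [Matrix.mul_neg, hA, neg_zero]
  have h2 : A + -A = 0 := add_neg_cancel A
  rw [twist, twist, mul_add, mul_one, add_mul, one_mul, h _ h1, add_zero, add_assoc, ← add_mul,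
    ← C_add, h2, C_0, zero_mul, add_zero]

theorem rowOf_one {N : ℕ} (i j : Fin N) : rowOf i (1 : MatPoly N) j = if i = j then 1 else 0 := by
  change matPolyEquiv.symm (1 : MatPoly N) i j = _
  rw [map_one, Matrix.one_apply]

theorem rowOf_C {N : ℕ} (i j : Fin N) (A : Mat N) : rowOf i (C A) j = C (A i j) := by
  change matPolyEquiv.symm (C A) i j = _
  rw [matPolyEquiv_symm_C]; rfl

theorem rowOf_mul_X {N : ℕ} (i j : Fin N) (P : MatPoly N) : rowOf i (P * X) j = rowOf i P j * X := by
  ext n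
  rw [coeff_rowOf]
  cases n with
  | zero => simp
  | succ n => rw [coeff_mul_X, coeff_mul_X, coeff_rowOf]

section form
variable {N : ℕ} [NeZero N]

theorem hat_twist (A : Mat N) (v : Row N) (k : Fin N) :
    hat (coeffOp (twist A)) v k = v k + X * ∑ i, C (A i k) * v i := by
  rw [hat_coeffOp]
  simp only [twist, map_add, Pi.add_apply, rowOf_one, rowOf_mul_X, rowOf_C, mul_add,
    Finset.sum_add_distrib, mul_ite, mul_one, mul_zero, Finset.sum_ite_eq', Finset.mem_univ,
    if_true, Finset.mul_sum]
  congr 1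
  exact Finset.sum_congr rfl fun i _ => by ring

theorem hat_twist_neg_twist {A : Mat N} (hA : A * A = 0) (v : Row N) :
    hat (coeffOp (twist (-A))) (hat (coeffOp (twist A)) v) = v := by
  rw [← hat_mul, ← coeffOp_mul, twist_mul_twist_neg hA, coeffOp_one, hat_one]

theorem hat_twist_twist_neg {A : Mat N} (hA : A * A = 0) (v : Row N) :
    hat (coeffOp (twist A)) (hat (coeffOp (twist (-A))) v) = v := by
  have h : (-A) * (-A) = 0 := by rw [neg_mul_neg, hA]
  simpa using hat_twist_neg_twist h v

theorem hat_twist_conjRow {A : Mat N} (hA : ∀ i j, starRingEnd ℂ (A i j) = A i j) (v : Row N) :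
    hat (coeffOp (twist A)) (conjRow v) = conjRow (hat (coeffOp (twist A)) v) := by
  ext1 k
  rw [hat_twist, conjRow, conjRow, hat_twist, map_add, map_mul, map_sum]
  simp only [map_mul, conjRow]
  simp [conjPoly, hA]

/-- The bilinear form `(v, w) ↦ ∑ₖ uₖ((v T)ₖ (w T)ₖ)`. -/
def tform (A : Mat N) (u : Fin N → ℂ[X] →ₗ[ℂ] ℂ) : Row N →ₗ[ℂ] Row N →ₗ[ℂ] ℂ :=
  ∑ k, ((LinearMap.mul ℂ ℂ[X]).compr₂ (u k)).compl₁₂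
    ((LinearMap.proj k).comp (hat (coeffOp (twist A))))
    ((LinearMap.proj k).comp (hat (coeffOp (twist A))))

theorem tform_apply (A : Mat N) (u : Fin N → ℂ[X] →ₗ[ℂ] ℂ) (v w : Row N) :
    tform A u v w = ∑ k, u k (hat (coeffOp (twist A)) v k * hat (coeffOp (twist A)) w k) := by
  simp [tform, LinearMap.sum_apply]

theorem tform_comm (A : Mat N) (u : Fin N → ℂ[X] →ₗ[ℂ] ℂ) (v w : Row N) :
    tform A u v w = tform A u w v := by
  simp only [tform_apply, mul_comm]

variable {A : Mat N} {u : Fin N → ℂ[X] →ₗ[ℂ] ℂ}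

theorem tform_conjRow (hA : ∀ i j, starRingEnd ℂ (A i j) = A i j)
    (hu : ∀ k, IsPositiveMoment (u k)) (v w : Row N) :
    tform A u (conjRow v) (conjRow w) = starRingEnd ℂ (tform A u v w) := by
  simp only [tform_apply, hat_twist_conjRow hA, map_sum]
  refine Finset.sum_congr rfl fun k _ => ?_
  rw [conjRow, conjRow, ← map_mul, (hu k).conj]

/-- Against its own conjugate, `v` gives the sum of the squared norms of the components of `v T`, so
`v T = 0`, and `T` is invertible. -/
theorem eq_zero_of_tform (hAA : A * A = 0) (hA : ∀ i j, starRingEnd ℂ (A i j) = A i j)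
    (hu : ∀ k, IsPositiveMoment (u k)) {v : Row N} (h : tform A u v (conjRow v) = 0) : v = 0 := by
  rw [tform_apply, hat_twist_conjRow hA] at h
  have hre := congrArg Complex.re h
  rw [Complex.re_sum, Complex.zero_re] at hre
  have hnn : ∀ p k, 0 ≤ (u k (p * conjPoly p)).re := fun p k => by
    by_cases hp : p = 0
    · simp [hp]
    · exact ((hu k).pos p hp).le
  have h0 := (Finset.sum_eq_zero_iff_of_nonneg (fun k _ => hnn _ k)).1 hre
  have h1 : hat (coeffOp (twist A)) v = 0 := by
    ext1 k
    by_contra hk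
    exact ((hu k).pos _ hk).ne' (h0 k (Finset.mem_univ k))
  rw [← hat_twist_neg_twist hAA v, h1, map_zero]

theorem exists_represent_tform (hAA : A * A = 0) (hA : ∀ i j, starRingEnd ℂ (A i j) = A i j)
    (hu : ∀ k, IsPositiveMoment (u k)) (n : ℕ) (f : Row N →ₗ[ℂ] ℂ) :
    ∃ w ∈ degLT N n, ∀ v ∈ degLT N n, f v = tform A u v w :=
  exists_represent _ _ (fun w hw h => eq_zero_of_tform hAA hA hu <| by
    rw [tform_comm]; exact h _ (conjRow_mem_degLT hw)) f

/-! ### Orthogonal sequences and the weight algebra -/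

variable {S : Set ℝ} {W : ℝ → Mat N}

/-- Gram–Schmidt: each `x ^ n e_r` is corrected by its projection to lower degrees. Membership in
`weightAlgebra` quantifies over all orthogonal sequences, so it carries information only once one
exists. -/
theorem exists_isOrthogonalSeq (hAA : A * A = 0) (hA : ∀ i j, starRingEnd ℂ (A i j) = A i j)
    (hu : ∀ k, IsPositiveMoment (u k))
    (hW : ∀ P Q i j, matInner S W P Q i j = tform A u (rowOf i P) (conjRow (rowOf j Q))) :
    ∃ P, IsOrthogonalSeq S W P := by
  have h1 : ∀ (n : ℕ) (r : Fin N), ∃ w ∈ degLT N n, ∀ v ∈ degLT N n,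
      tform A u v (Pi.single r (X ^ n)) = tform A u v w := fun n r =>
    exists_represent_tform hAA hA hu n ((tform A u).flip (Pi.single r (X ^ n)))
  choose w hw hw' using h1
  let P : ℕ → MatPoly N := fun n =>
    matPolyEquiv (Matrix.of fun i => (Pi.single i (X ^ n) : Row N) - w n i)
  have hrow : ∀ n r, rowOf r (P n) = Pi.single r (X ^ n) - w n r := fun n r => by
    ext j m
    rw [coeff_rowOf, matPolyEquiv_coeff_apply]; rfl
  have hcn : ∀ n, (P n).coeff n = 1 := fun n => by
    ext i j
    rw [← coeff_rowOf, hrow, Pi.sub_apply, coeff_sub, mem_degLT_iff_coeff.1 (hw n i) j n le_rfl,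
      sub_zero, Matrix.one_apply, Pi.single_apply]
    by_cases hij : i = j
    · simp [hij]
    · simp [hij, Ne.symm hij]
  have hdeg : ∀ n, (P n).natDegree = n := fun n => by
    refine natDegree_eq_of_le_of_coeff_ne_zero ?_ (by rw [hcn]; exact one_ne_zero)
    rw [natDegree_le_iff_coeff_eq_zero]
    intro m hm
    ext i j
    rw [← coeff_rowOf, hrow, Pi.sub_apply, coeff_sub, mem_degLT_iff_coeff.1 (hw n i) j m hm.le,
      Pi.single_apply]
    split_ifs <;> simp [coeff_X_pow, hm.ne']
  have horth : ∀ m n, m < n → ∀ i j, tform A u (conjRow (rowOf i (P m))) (rowOf j (P n)) = 0 := by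
    intro m n hmn i j
    rw [hrow n, map_sub, sub_eq_zero]
    exact hw' _ _ _ (conjRow_mem_degLT (degLT_mono hmn (rowOf_mem_degLT (hdeg m).le i)))
  refine ⟨P, hdeg, fun n => ?_, fun n m hnm => ?_⟩
  · rw [leadingCoeff, hdeg, hcn]; exact isUnit_one
  · ext i j
    rw [hW, Matrix.zero_apply]
    rcases hnm.lt_or_gt with h | h
    · have := tform_conjRow hA hu (conjRow (rowOf i (P n))) (rowOf j (P m))
      rw [horth n m h, map_zero, conjRow_conjRow] at this
      exact this
    · rw [tform_comm]; exact horth m n h j i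

theorem tform_rowOf_eq_zero {P : ℕ → MatPoly N} (hP : IsOrthogonalSeq S W P)
    (hW : ∀ P Q i j, matInner S W P Q i j = tform A u (rowOf i P) (conjRow (rowOf j Q)))
    {n k : ℕ} (hnk : n ≤ k) (r : Fin N) {w : Row N} (hw : w ∈ degLT N n) :
    tform A u (rowOf r (P k)) w = 0 := by
  let T : Submodule ℂ (Row N) :=
    { carrier := {w | tform A u (rowOf r (P k)) (conjRow w) = 0}
      add_mem' := fun {v w} hv hw => by
        simp only [Set.mem_ofPred_eq] at hv hw ⊢
        rw [conjRow_add, map_add, hv, hw, add_zero]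
      zero_mem' := by
        have : conjRow (0 : Row N) = 0 := by ext1 i; exact map_zero conjPoly
        simp [this]
      smul_mem' := fun c v hv => by
        simp only [Set.mem_ofPred_eq] at hv ⊢
        rw [conjRow_smul, map_smul, hv, smul_zero] }
  have h := degLT_le_of_rowOf_mem hP.natDegree_eq hP.isUnit_leadingCoeff T n (fun m hm s => by
    change tform A u (rowOf r (P k)) (conjRow (rowOf s (P m))) = 0
    rw [← hW, hP.orthogonal k m (by omega)]; rfl)
  have h2 : tform A u (rowOf r (P k)) (conjRow (conjRow w)) = 0 := h (conjRow_mem_degLT hw)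
  rwa [conjRow_conjRow] at h2

/-- `D` preserves the span of the rows of each `P k`. Hence it preserves degrees, and for `w` of
degree below `n` the functional `v ↦ ⟨v D, w⟩` vanishes on the rows of `P k` for `k ≥ n`; a vector
representing it on degrees below `n` therefore represents it everywhere. -/
theorem hat_mem_degLT_and_exists_adjoint (hAA : A * A = 0)
    (hA : ∀ i j, starRingEnd ℂ (A i j) = A i j) (hu : ∀ k, IsPositiveMoment (u k))
    (hW : ∀ P Q i j, matInner S W P Q i j = tform A u (rowOf i P) (conjRow (rowOf j Q)))
    {D : RightOp N} (hD : D ∈ weightAlgebra S W) (n : ℕ) :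
    (∀ v ∈ degLT N n, hat D v ∈ degLT N n) ∧
      ∀ w ∈ degLT N n, ∃ w' ∈ degLT N n, ∀ v, tform A u (hat D v) w = tform A u v w' := by
  obtain ⟨P, hP⟩ := exists_isOrthogonalSeq hAA hA hu hW
  choose L hL using hD.2 P hP
  have hrow : ∀ k r, hat D (rowOf r (P k)) = ∑ s, L k r s • rowOf s (P k) := fun k r => by
    rw [← rowOf_act, hL, rowOf_C_mul]
  constructor
  · exact degLT_le_of_rowOf_mem hP.natDegree_eq hP.isUnit_leadingCoeff
      ((degLT N n).comap (hat D)) n (fun k hk r => by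
        rw [Submodule.mem_comap, hrow]
        exact Submodule.sum_mem _ fun s _ => Submodule.smul_mem _ _
          (degLT_mono hk (rowOf_mem_degLT (hP.natDegree_eq k).le s)))
  · intro w hw
    obtain ⟨w', hw', h⟩ := exists_represent_tform hAA hA hu n (((tform A u).flip w).comp (hat D))
    refine ⟨w', hw', fun v => ?_⟩
    obtain ⟨m, hm⟩ := exists_mem_degLT v
    have key := degLT_le_of_rowOf_mem hP.natDegree_eq hP.isUnit_leadingCoeff
      (LinearMap.eqLocus (((tform A u).flip w).comp (hat D)) ((tform A u).flip w')) m
      (fun k _ r => by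
        rw [LinearMap.mem_eqLocus]
        rcases lt_or_ge k n with hk | hk
        · exact h _ (degLT_mono hk (rowOf_mem_degLT (hP.natDegree_eq k).le r))
        · simp only [LinearMap.comp_apply, LinearMap.flip_apply]
          rw [tform_rowOf_eq_zero hP hW hk r hw', hrow, map_sum, LinearMap.sum_apply]
          refine Finset.sum_eq_zero fun s _ => ?_
          rw [map_smul, LinearMap.smul_apply, tform_rowOf_eq_zero hP hW hk s hw, smul_zero])
    exact LinearMap.mem_eqLocus.1 (key hm)

/-- Subtract from a row of `P n · D` the combination of rows of `P n` with the same leading part. By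
symmetry the remainder is orthogonal to all lower degrees, and it has lower degree itself, so it is
zero. -/
theorem mem_weightAlgebra_of_symmetric (hAA : A * A = 0)
    (hA : ∀ i j, starRingEnd ℂ (A i j) = A i j) (hu : ∀ k, IsPositiveMoment (u k))
    (hW : ∀ P Q i j, matInner S W P Q i j = tform A u (rowOf i P) (conjRow (rowOf j Q)))
    {D : RightOp N} (hD : D ∈ matDiffOps N) (hdeg : ∀ n, ∀ v ∈ degLT N n, hat D v ∈ degLT N n)
    (hsymm : ∀ v w, tform A u (hat D v) w = tform A u v (hat D w)) :
    D ∈ weightAlgebra S W := by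
  refine ⟨hD, fun P hP n => ?_⟩
  have hrow : ∀ r, rowOf r (P n) ∈ degLT N (n + 1) := fun r =>
    rowOf_mem_degLT (hP.natDegree_eq n).le r
  have h1 : ∀ r, ∃ c : Fin N → ℂ, hat D (rowOf r (P n)) = ∑ s, c s • rowOf s (P n) := fun r => by
    obtain ⟨c, hc⟩ := exists_sub_sum_rowOf_mem (hP.natDegree_eq n) (hP.isUnit_leadingCoeff n)
      (hdeg _ _ (hrow r))
    refine ⟨c, sub_eq_zero.1 (eq_zero_of_tform hAA hA hu ?_)⟩
    have hc' := conjRow_mem_degLT hc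
    rw [map_sub, LinearMap.sub_apply, hsymm, tform_rowOf_eq_zero hP hW le_rfl r (hdeg _ _ hc'),
      map_sum, LinearMap.sum_apply, zero_sub, neg_eq_zero]
    refine Finset.sum_eq_zero fun s _ => ?_
    rw [map_smul, LinearMap.smul_apply, tform_rowOf_eq_zero hP hW le_rfl s hc', smul_zero]
  choose c hc using h1
  refine ⟨Matrix.of c, ext_rowOf fun r => ?_⟩
  rw [rowOf_act, hc, rowOf_C_mul]; rfl

end form

/-! ### Scalar differential operators and Pearson functionals -/

/-- `E` is a differential operator with polynomial coefficients. -/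
def IsScalarDiffOp (E : ℂ[X] →ₗ[ℂ] ℂ[X]) : Prop :=
  ∃ (m : ℕ) (f : ℕ → ℂ[X]), ∀ p, E p = ∑ k ∈ Finset.range m, derivative^[k] p * f k

/-- The Pearson equation `(φ u)' = τ u` in weak form. -/
def IsPearson (u : ℂ[X] →ₗ[ℂ] ℂ) (φ τ : ℂ[X]) : Prop :=
  ∀ p, u (φ * derivative p + τ * p) = 0

theorem IsPearson.apply_derivative_mul {u : ℂ[X] →ₗ[ℂ] ℂ} {φ τ : ℂ[X]} (hu : IsPearson u φ τ)
    (p g : ℂ[X]) : u (φ * derivative p * g) = -u (p * (φ * derivative g + τ * g)) := by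
  have h := hu (p * g)
  rw [derivative_mul, show φ * (derivative p * g + p * derivative g) + τ * (p * g)
    = φ * derivative p * g + p * (φ * derivative g + τ * g) by ring, map_add] at h
  exact eq_neg_of_add_eq_zero_left h

/-- Integrate by parts `k` times. The Pearson equation moves a derivative only in the presence of a
factor `φ`, and each move uses one up; hence the power `φ ^ m` with `k ≤ m`. -/
theorem IsPearson.exists_adjoint_derivative {u : ℂ[X] →ₗ[ℂ] ℂ} {φ τ : ℂ[X]}
    (hu : IsPearson u φ τ) (k : ℕ) : ∀ (m : ℕ), k ≤ m → ∀ r : ℂ[X], ∃ g : ℂ[X], ∀ p,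
      u (derivative^[k] p * (φ ^ m * r)) = u (p * g) := by
  induction k with
  | zero => exact fun m _ r => ⟨φ ^ m * r, fun p => rfl⟩
  | succ k ih =>
    intro m hm r
    obtain ⟨m, rfl⟩ : ∃ l, m = l + 1 := ⟨m - 1, by omega⟩
    by_cases hk : m = 0
    · subst hk
      obtain rfl : k = 0 := by omega
      refine ⟨-(φ * derivative r + τ * r), fun p => ?_⟩
      rw [mul_neg, map_neg, ← hu.apply_derivative_mul]
      congr 1
      simp only [zero_add, pow_one, Function.iterate_one]
      ring
    · obtain ⟨l, rfl⟩ : ∃ l, m = l + 1 := ⟨m - 1, by omega⟩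
      obtain ⟨g, hg⟩ := ih (l + 1) (by omega)
        (-(((l + 1 : ℕ) : ℂ[X]) * derivative φ * r + φ * derivative r + τ * r))
      refine ⟨g, fun p => ?_⟩
      rw [← hg, Function.iterate_succ_apply']
      have := hu.apply_derivative_mul (derivative^[k] p) (φ ^ (l + 1) * r)
      rw [← map_neg] at this
      convert this using 2
      · ring
      · rw [derivative_mul, derivative_pow, Nat.add_sub_cancel, C_eq_natCast]
        ring

/-- Two functionals related by a rational function with the given logarithmic derivative. -/
theorem eq_zero_of_mul_eq_mul {u v : ℂ[X] →ₗ[ℂ] ℂ} {φ τ σ : ℂ[X]}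
    (hu : IsPositiveMoment u) (hv : IsPositiveMoment v) (pu : IsPearson u φ τ)
    (pv : IsPearson v φ σ)
    (hrat : ∀ g h, φ * (derivative g * h - g * derivative h) = (σ - τ) * (g * h) →
      g = 0 ∨ h = 0)
    {g h : ℂ[X]} (hgh : ∀ p, u (p * g) = v (p * h)) : g = 0 := by
  -- The hypothesis says `g u = h v`. Differentiating it with the two Pearson equations gives a
  -- second such relation, and eliminating `u` between the two leaves a polynomial multiple of `v`
  -- that vanishes.
  have h1 : ∀ p, u (p * (φ * derivative g + τ * g)) = v (p * (φ * derivative h + σ * h)) :=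
    fun p => by
      have := hgh (φ * derivative p)
      rw [pu.apply_derivative_mul, pv.apply_derivative_mul] at this
      exact neg_injective this
  have h2 : ∀ p, v (p * (g * (φ * derivative h + σ * h) - h * (φ * derivative g + τ * g))) = 0 :=
    fun p => by
      have e1 := h1 (p * g)
      have e2 := hgh (p * (φ * derivative g + τ * g))
      rw [mul_sub, map_sub, sub_eq_zero, ← mul_assoc, ← e1,
        show p * (h * (φ * derivative g + τ * g)) = p * (φ * derivative g + τ * g) * h by ring,
        ← e2]
      congr 1
      ring
  have h3 : g * (φ * derivative h + σ * h) - h * (φ * derivative g + τ * g) = 0 :=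
    hv.eq_zero (by rw [mul_comm]; exact h2 _)
  rcases hrat g h (by linear_combination -h3) with h0 | h0
  · exact h0
  · refine hu.eq_zero ?_
    rw [mul_comm, hgh, h0, mul_zero, map_zero]

/-- On test functions `φ ^ m * r` the operator has two adjoints: one relative to `u`, by integration
by parts, and one relative to `v`, by hypothesis. They give `g u = h v`, so `g = 0` by
non-rationality, and then `u` annihilates every `E p * φ ^ m * r`. -/
theorem IsScalarDiffOp.eq_zero {E : ℂ[X] →ₗ[ℂ] ℂ[X]} (hE : IsScalarDiffOp E)
    {u v : ℂ[X] →ₗ[ℂ] ℂ} {φ τ σ : ℂ[X]} (hφ : φ ≠ 0)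
    (hu : IsPositiveMoment u) (hv : IsPositiveMoment v) (pu : IsPearson u φ τ)
    (pv : IsPearson v φ σ)
    (hrat : ∀ g h, φ * (derivative g * h - g * derivative h) = (σ - τ) * (g * h) →
      g = 0 ∨ h = 0)
    (hadj : ∀ q, ∃ h, ∀ p, u (E p * q) = v (p * h)) (p : ℂ[X]) : E p = 0 := by
  obtain ⟨m, f, hf⟩ := hE
  have key : ∀ r, u (E p * (φ ^ m * r)) = 0 := by
    intro r
    have h1 : ∀ k : ℕ, ∃ g : ℂ[X], k ∈ Finset.range m → ∀ p,
        u (derivative^[k] p * (φ ^ m * (f k * r))) = u (p * g) := fun k => by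
      by_cases hk : k ∈ Finset.range m
      · obtain ⟨g, hg⟩ := pu.exists_adjoint_derivative k m (Finset.mem_range.1 hk).le (f k * r)
        exact ⟨g, fun _ => hg⟩
      · exact ⟨0, fun h => absurd h hk⟩
    choose g hg using h1
    have h2 : ∀ p, u (E p * (φ ^ m * r)) = u (p * ∑ k ∈ Finset.range m, g k) := fun p => by
      rw [hf, Finset.sum_mul, Finset.mul_sum, map_sum, map_sum]
      refine Finset.sum_congr rfl fun k hk => ?_
      rw [← hg k hk]
      congr 1
      ring
    obtain ⟨h, hh⟩ := hadj (φ ^ m * r)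
    have h3 := eq_zero_of_mul_eq_mul hu hv pu pv hrat (fun p => (h2 p).symm.trans (hh p))
    rw [h2, h3, mul_zero, map_zero]
  have h4 : E p * φ ^ m = 0 := hu.eq_zero (by rw [mul_assoc]; exact key _)
  exact (mul_eq_zero.1 h4).resolve_right (pow_ne_zero m hφ)

/-- Only the coefficient of `x ^ k` in `f k` contributes, multiplied by the falling factorial of
`n`, which is polynomial in `n`. -/
theorem IsScalarDiffOp.exists_symbol {E : ℂ[X] →ₗ[ℂ] ℂ[X]} (hE : IsScalarDiffOp E) :
    ∃ e : ℂ[X], ∀ n : ℕ, (E (X ^ n)).coeff n = e.eval (n : ℂ) := by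
  obtain ⟨m, f, hf⟩ := hE
  refine ⟨∑ k ∈ Finset.range m, C ((f k).coeff k) * descPochhammer ℂ k, fun n => ?_⟩
  rw [hf, finsetSum_coeff, eval_finsetSum]
  refine Finset.sum_congr rfl fun k _ => ?_
  rw [iterate_derivative_X_pow_eq_smul, eval_mul, eval_C, descPochhammer_eval_eq_descFactorial,
    smul_mul_assoc, coeff_smul, coeff_X_pow_mul', smul_eq_mul]
  split_ifs with h
  -- For `k > n` the truncated difference `n - (n - k)` is not `k`, but the falling factorial is
  -- zero.
  · rcases le_or_gt k n with hk | hk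
    · rw [Nat.sub_sub_self hk, mul_comm]
    · rw [Nat.descFactorial_of_lt hk]; simp
  · omega

/-! ### Scalar orthogonal polynomials -/

/-- The condition `X ^ n - p ∈ degreeLT ℂ n` is how "monic of degree `n`" is expressed from here on.
-/
theorem exists_monic_orthogonal {u : ℂ[X] →ₗ[ℂ] ℂ} (hu : IsPositiveMoment u) (n : ℕ) :
    ∃ p : ℂ[X], X ^ n - p ∈ degreeLT ℂ n ∧ ∀ q ∈ degreeLT ℂ n, u (p * q) = 0 := by
  have : FiniteDimensional ℂ (degreeLT ℂ n) := Module.Finite.equiv (degreeLTEquiv ℂ n).symm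
  let B : ℂ[X] →ₗ[ℂ] ℂ[X] →ₗ[ℂ] ℂ := (LinearMap.mul ℂ ℂ[X]).compr₂ u
  obtain ⟨w, hw, h⟩ := exists_represent B (degreeLT ℂ n)
    (fun w hw h => hu.eq_zero (by rw [mul_comm]; exact h _ (conjPoly_mem_degreeLT hw)))
    (B.flip (X ^ n))
  refine ⟨X ^ n - w, by simpa using hw, fun q hq => ?_⟩
  have := h q hq
  rw [sub_mul, map_sub, sub_eq_zero, mul_comm, mul_comm w]
  exact this

theorem X_pow_mem_degreeLT {n m : ℕ} (h : n < m) : (X ^ n : ℂ[X]) ∈ degreeLT ℂ m := by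
  rw [mem_degreeLT, degree_X_pow]; exact_mod_cast h

theorem sub_coeff_smul_mem_degreeLT {n : ℕ} {p q : ℂ[X]} (hp : p ∈ degreeLT ℂ (n + 1))
    (hq : X ^ n - q ∈ degreeLT ℂ n) : p - p.coeff n • q ∈ degreeLT ℂ n := by
  rw [mem_degreeLT_iff_coeff] at hp hq ⊢
  intro m hm
  have h := hq m hm
  rw [coeff_sub, sub_eq_zero] at h
  rw [coeff_sub, coeff_smul, ← h, coeff_X_pow]
  split_ifs with hmn
  · subst hmn; simp
  · rw [hp m (by omega)]; simp

theorem ne_zero_of_X_pow_sub_mem {n : ℕ} {q : ℂ[X]} (hq : X ^ n - q ∈ degreeLT ℂ n) : q ≠ 0 := by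
  rintro rfl
  have := mem_degreeLT_iff_coeff.1 hq n le_rfl
  simp at this

/-- As the adjoint preserves degrees, `E p` is again orthogonal to lower degrees. So is its
difference from the multiple of `p` with the same leading coefficient, and that difference has lower
degree. -/
theorem apply_eq_smul_of_orthogonal {u : ℂ[X] →ₗ[ℂ] ℂ} (hu : IsPositiveMoment u)
    {E : ℂ[X] →ₗ[ℂ] ℂ[X]} (hE : ∀ n, ∀ p ∈ degreeLT ℂ n, E p ∈ degreeLT ℂ n)
    (hadj : ∀ n, ∀ q ∈ degreeLT ℂ n, ∃ h ∈ degreeLT ℂ n, ∀ p, u (E p * q) = u (p * h))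
    {n : ℕ} {p : ℂ[X]} (hp : X ^ n - p ∈ degreeLT ℂ n)
    (horth : ∀ q ∈ degreeLT ℂ n, u (p * q) = 0) :
    E p = (E (X ^ n)).coeff n • p := by
  have hX := hE (n + 1) (X ^ n) (X_pow_mem_degreeLT n.lt_succ_self)
  have h1 : E p - (E (X ^ n)).coeff n • p ∈ degreeLT ℂ n := by
    have := Submodule.sub_mem _ (sub_coeff_smul_mem_degreeLT hX hp) (hE n _ hp)
    rw [map_sub] at this
    convert this using 1
    abel
  refine sub_eq_zero.1 (hu.eq_zero ?_)
  obtain ⟨h, hh, hh'⟩ := hadj n _ (conjPoly_mem_degreeLT h1)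
  rw [sub_mul, map_sub, hh', horth h hh, smul_mul_assoc, map_smul,
    horth _ (conjPoly_mem_degreeLT h1), smul_zero, sub_zero]

theorem eq_zero_of_forall_monic {E : ℂ[X] →ₗ[ℂ] ℂ[X]} {q : ℕ → ℂ[X]}
    (hq : ∀ n, X ^ n - q n ∈ degreeLT ℂ n) (hE : ∀ n, E (q n) = 0) (p : ℂ[X]) : E p = 0 := by
  have key : ∀ n, ∀ p ∈ degreeLT ℂ n, E p = 0 := fun n => by
    induction n with
    | zero =>
      intro p hp
      have : p = 0 := by ext m; exact mem_degreeLT_iff_coeff.1 hp m (Nat.zero_le _)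
      rw [this, map_zero]
    | succ n ih =>
      intro p hp
      have := ih _ (sub_coeff_smul_mem_degreeLT hp (hq n))
      rwa [map_sub, map_smul, hE, smul_zero, sub_zero] at this
  refine key (p.natDegree + 1) p (mem_degreeLT_iff_coeff.2 fun m hm => ?_)
  exact coeff_eq_zero_of_natDegree_lt (by omega)

/-! ### Eigenvalues of operators commuting with a Jacobi operator -/

theorem jacobi_iterate_derivative {p : ℂ[X]} {t₀ t₁ c : ℂ}
    (h : (1 - X ^ 2) * derivative (derivative p) + (C t₀ + C t₁ * X) * derivative p = C c * p)
    (k : ℕ) :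
    (1 - X ^ 2) * derivative^[k + 2] p + (C t₀ + C t₁ * X - 2 * (k : ℂ[X]) * X) *
      derivative^[k + 1] p = C (c + k * (k - 1) - k * t₁) * derivative^[k] p := by
  induction k with
  | zero =>
    simp only [Function.iterate_succ_apply', Function.iterate_zero_apply]
    simp only [CharP.cast_eq_zero, mul_zero, zero_mul, sub_zero, add_zero]
    exact h
  | succ k ih =>
    have h1 := congrArg derivative ih
    simp only [derivative_add, derivative_mul, derivative_sub, derivative_one, derivative_X_pow,
      derivative_C, derivative_X, derivative_natCast, derivative_ofNat,
      ← Function.iterate_succ_apply' (⇑derivative)] at h1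
    simp only [C_add, C_sub, C_mul, C_eq_natCast, C_1, Nat.cast_add, Nat.cast_one,
      Nat.cast_ofNat] at h1 ⊢
    rw [show (C (2 : ℂ) : ℂ[X]) = 2 from map_ofNat C 2] at h1
    linear_combination h1

/-- At `x = -1` the second-order term drops out of the differentiated equation, leaving a
first-order recursion for the derivatives there. So the `k`-th derivative of `q n` at `-1` is `(R
k).eval (l n)` times `q n` at `-1`, and the latter is nonzero, else all Taylor coefficients would
vanish. Evaluating `E (q n) = e n • q n` at `-1` expresses `e n` through `l n`. -/
theorem exists_eval_eigenvalue_of_jacobi {E : ℂ[X] →ₗ[ℂ] ℂ[X]} (hE : IsScalarDiffOp E)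
    {t₀ t₁ : ℂ} (ht : ∀ k : ℕ, t₀ - t₁ + 2 * k ≠ 0) {q : ℕ → ℂ[X]} {e l : ℕ → ℂ}
    (hq : ∀ n, q n ≠ 0) (hEq : ∀ n, E (q n) = e n • q n)
    (hl : ∀ n, (1 - X ^ 2) * derivative (derivative (q n)) +
      (C t₀ + C t₁ * X) * derivative (q n) = C (l n) * q n) :
    ∃ P : ℂ[X], ∀ n, e n = P.eval (l n) := by
  obtain ⟨m, f, hf⟩ := hE
  let R : ℕ → ℂ[X] := fun k => Nat.rec 1
    (fun k r => C ((t₀ - t₁ + 2 * k)⁻¹) * (X + C (k * (k - 1) - k * t₁)) * r) k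
  have hR : ∀ n k, (derivative^[k] (q n)).eval (-1) = (R k).eval (l n) * (q n).eval (-1) := by
    intro n k
    induction k with
    | zero => simp [R]
    | succ k ih =>
      have h1 := congrArg (eval (-1)) (jacobi_iterate_derivative (hl n) k)
      simp only [eval_add, eval_mul, eval_sub, eval_one, eval_pow, eval_X, eval_C, eval_natCast,
        eval_ofNat, ih] at h1
      have h2 : R (k + 1) = C ((t₀ - t₁ + 2 * k)⁻¹) * (X + C (k * (k - 1) - k * t₁)) * R k := rfl
      rw [h2, eval_mul, eval_mul, eval_C, eval_add, eval_X, eval_C]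
      have h3 := ht k
      field_simp
      linear_combination h1
  have h0 : ∀ n, (q n).eval (-1) ≠ 0 := by
    intro n h
    refine hq n (taylor_injective (-1) (ext fun k => ?_))
    rw [taylor_coeff, map_zero, coeff_zero]
    have h1 := hR n k
    rw [h, mul_zero, ← factorial_smul_hasseDeriv] at h1
    simpa [eval_smul, Nat.factorial_ne_zero] using h1
  refine ⟨∑ k ∈ Finset.range m, R k * C ((f k).eval (-1)), fun n => ?_⟩
  have h1 := congrArg (eval (-1)) (hEq n)
  rw [hf, eval_finsetSum, eval_smul, smul_eq_mul] at h1
  refine mul_right_cancel₀ (h0 n) (h1.symm.trans ?_)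
  rw [eval_finsetSum, Finset.sum_mul]
  refine Finset.sum_congr rfl fun k _ => ?_
  rw [eval_mul, eval_mul, hR, eval_C]
  ring

/-! ### Non-rationality criteria -/

/-- The exponential `e^{cx}` is not rational: the left side has smaller degree than `g * h`. -/
theorem eq_zero_or_eq_zero_of_derivative_eq {c : ℂ} (hc : c ≠ 0) {g h : ℂ[X]}
    (hgh : derivative g * h - g * derivative h = C c * (g * h)) : g = 0 ∨ h = 0 := by
  by_contra! H
  have h1 : (derivative g * h - g * derivative h).degree < (g * h).degree := by
    refine (degree_sub_le _ _).trans_lt (max_lt ?_ ?_)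
    · rw [degree_mul, degree_mul]
      exact WithBot.add_lt_add_right (degree_ne_bot.2 H.2) (degree_derivative_lt H.1)
    · rw [degree_mul, degree_mul]
      exact WithBot.add_lt_add_left (degree_ne_bot.2 H.1) (degree_derivative_lt H.2)
  rw [hgh, degree_C_mul hc] at h1
  exact lt_irrefl _ h1

/-- The logarithmic derivative of `g / h` has an integer residue at `r`, the difference of the two
root multiplicities; comparing at `r` gives `ψ(r)` times this integer equal to `ρ(r)`. -/
theorem eq_zero_or_eq_zero_of_root {r : ℂ} {ψ ρ : ℂ[X]}
    (hρ : ∀ n : ℤ, ψ.eval r * n ≠ ρ.eval r) {g h : ℂ[X]}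
    (hgh : (X - C r) * ψ * (derivative g * h - g * derivative h) = ρ * (g * h)) :
    g = 0 ∨ h = 0 := by
  by_contra! H
  obtain ⟨g₁, hg, hg'⟩ := exists_eq_pow_rootMultiplicity_mul_and_not_dvd g H.1 r
  obtain ⟨h₁, hh, hh'⟩ := exists_eq_pow_rootMultiplicity_mul_and_not_dvd h H.2 r
  rw [dvd_iff_isRoot, IsRoot.def] at hg' hh'
  generalize rootMultiplicity r g = m at hg
  generalize rootMultiplicity r h = n at hh
  have hd : ∀ (k : ℕ) (s : ℂ[X]), (X - C r) * derivative ((X - C r) ^ k * s) =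
      (X - C r) ^ k * ((k : ℂ[X]) * s + (X - C r) * derivative s) := fun k s => by
    rw [derivative_mul, derivative_pow]
    cases k with
    | zero => simp
    | succ k => simp; ring
  have h1 : ψ * (((X - C r) * derivative g) * h - g * ((X - C r) * derivative h)) = ρ * (g * h) := by
    rw [← hgh]; ring
  rw [hg, hh, hd, hd] at h1
  have h2 : (X - C r) ^ (m + n) * (ψ * (((m : ℂ[X]) * g₁ + (X - C r) * derivative g₁) * h₁ -
      g₁ * ((n : ℂ[X]) * h₁ + (X - C r) * derivative h₁))) = (X - C r) ^ (m + n) * (ρ * (g₁ * h₁)) := by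
    rw [pow_add]; linear_combination h1
  have h3 := congrArg (eval r) (mul_left_cancel₀ (pow_ne_zero _ (X_sub_C_ne_zero r)) h2)
  simp only [eval_mul, eval_sub, eval_add, eval_X, eval_C, eval_natCast, sub_self, zero_mul,
    add_zero] at h3
  refine hρ ((m : ℤ) - n) (mul_right_cancel₀ (mul_ne_zero hg' hh') ?_)
  push_cast
  linear_combination h3

/-! ### Operators conjugated by the twist -/

section conj
variable {N : ℕ} [NeZero N]

/-- The conjugate `T⁻¹ D T` (in the right-action convention), where `T⁻¹ = 1 - A x`. -/
def conjOp (A : Mat N) (D : RightOp N) : RightOp N :=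
  coeffOp (twist (-A)) * D * coeffOp (twist A)

/-- The `(i, j)` entry of a right operator, acting on scalar polynomials. -/
def entry (E : RightOp N) (i j : Fin N) : ℂ[X] →ₗ[ℂ] ℂ[X] :=
  (LinearMap.proj j).comp ((hat E).comp (LinearMap.single ℂ (fun _ => ℂ[X]) i))

theorem entry_apply (E : RightOp N) (i j : Fin N) (p : ℂ[X]) :
    entry E i j p = hat E (Pi.single i p) j := rfl

omit [NeZero N] in
theorem coeffOp_mem_matDiffOps (F : MatPoly N) : coeffOp F ∈ matDiffOps N :=
  ⟨Finsupp.single 0 F, by rw [diffOp_single, pow_zero, one_mul]⟩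

omit [NeZero N] in
theorem conjOp_mem_matDiffOps (A : Mat N) {D : RightOp N} (hD : D ∈ matDiffOps N) :
    conjOp A D ∈ matDiffOps N :=
  mul_mem (mul_mem (coeffOp_mem_matDiffOps _) hD) (coeffOp_mem_matDiffOps _)

theorem isScalarDiffOp_entry {E : RightOp N} (hE : E ∈ matDiffOps N) (i j : Fin N) :
    IsScalarDiffOp (entry E i j) := by
  obtain ⟨F, rfl⟩ := hE
  refine ⟨F.support.sup id + 1, fun k => rowOf i (F k) j, fun p => ?_⟩
  have h0 : ∀ k : ℕ, derivative^[k] (0 : ℂ[X]) = 0 := fun k => iterate_derivative_zero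
  rw [entry_apply, hat_diffOp, Finsupp.sum_of_support_subset F
    (s := Finset.range (F.support.sup id + 1))]
  · refine Finset.sum_congr rfl fun k _ => ?_
    rw [Finset.sum_eq_single i (fun b _ hb => by rw [Pi.single_eq_of_ne hb, h0, zero_mul])
      (by simp), Pi.single_eq_same]
  · intro k hk
    rw [Finset.mem_range, Nat.lt_succ_iff]
    exact Finset.le_sup (f := id) hk
  · simp

theorem hat_conjOp (A : Mat N) (D : RightOp N) (v : Row N) :
    hat (conjOp A D) v = hat (coeffOp (twist A)) (hat D (hat (coeffOp (twist (-A))) v)) := by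
  rw [conjOp, hat_mul, hat_mul]

/-- A twisting matrix with a system of positive functionals subject to Pearson equations with
the same leading polynomial, no two of which are related by a rational function. -/
structure IsTwistSystem (A : Mat N) (u : Fin N → ℂ[X] →ₗ[ℂ] ℂ) (φ : ℂ[X])
    (τ : Fin N → ℂ[X]) : Prop where
  mul_eq_zero : ∀ i j k, A i j * A j k = 0
  real : ∀ i j, starRingEnd ℂ (A i j) = A i j
  linked : ∀ i j : Fin N, j.val = i.val + 1 → A i j ≠ 0 ∨ A j i ≠ 0
  pos : ∀ k, IsPositiveMoment (u k)
  pearson : ∀ k, IsPearson (u k) φ (τ k)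
  phi_ne_zero : φ ≠ 0
  not_rational : ∀ i j, i ≠ j → ∀ g h,
    φ * (derivative g * h - g * derivative h) = (τ j - τ i) * (g * h) → g = 0 ∨ h = 0

/-! ### Structure of the algebra of a twisted diagonal weight -/

namespace IsTwistSystem

variable {A : Mat N} {u : Fin N → ℂ[X] →ₗ[ℂ] ℂ} {φ : ℂ[X]} {τ : Fin N → ℂ[X]}
  {S : Set ℝ} {W : ℝ → Mat N}

omit [NeZero N] in
theorem sq_eq_zero (h : IsTwistSystem A u φ τ) : A * A = 0 := by
  ext i k
  rw [Matrix.mul_apply]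
  exact Finset.sum_eq_zero fun j _ => h.mul_eq_zero i j k

omit [NeZero N] in
theorem diag_eq_zero (h : IsTwistSystem A u φ τ) (i : Fin N) : A i i = 0 :=
  mul_self_eq_zero.1 (h.mul_eq_zero i i i)

theorem hat_twist_hat (h : IsTwistSystem A u φ τ) (D : RightOp N) (v : Row N) :
    hat (coeffOp (twist A)) (hat D v) = hat (conjOp A D) (hat (coeffOp (twist A)) v) := by
  rw [hat_conjOp, hat_twist_neg_twist h.sq_eq_zero]

theorem hat_eq (h : IsTwistSystem A u φ τ) (D : RightOp N) (v : Row N) :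
    hat D v = hat (coeffOp (twist (-A))) (hat (conjOp A D) (hat (coeffOp (twist A)) v)) := by
  rw [← h.hat_twist_hat, hat_twist_neg_twist h.sq_eq_zero]

/-- The adjoint of `D` is tested on `e_i p T⁻¹` and `e_j q T⁻¹`: the twists cancel and a single term
of each sum survives. -/
theorem exists_adjoint_entry (h : IsTwistSystem A u φ τ)
    (hW : ∀ P Q i j, matInner S W P Q i j = tform A u (rowOf i P) (conjRow (rowOf j Q)))
    {D : RightOp N} (hD : D ∈ weightAlgebra S W) (j : Fin N) (n : ℕ) (q : ℂ[X])
    (hq : hat (coeffOp (twist (-A))) (Pi.single j q) ∈ degLT N n) :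
    ∃ w ∈ degLT N n, ∀ i p, u j (entry (conjOp A D) i j p * q) =
      u i (p * hat (coeffOp (twist A)) w i) := by
  obtain ⟨w, hw, hw'⟩ :=
    (hat_mem_degLT_and_exists_adjoint h.sq_eq_zero h.real h.pos hW hD n).2 _ hq
  refine ⟨w, hw, fun i p => ?_⟩
  have := hw' (hat (coeffOp (twist (-A))) (Pi.single i p))
  rw [tform_apply, tform_apply, h.hat_twist_hat, hat_twist_twist_neg h.sq_eq_zero,
    hat_twist_twist_neg h.sq_eq_zero, Finset.sum_eq_single j (fun b _ hb => by
      rw [Pi.single_eq_of_ne hb, mul_zero, map_zero]) (by simp),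
    Finset.sum_eq_single i (fun b _ hb => by
      rw [Pi.single_eq_of_ne hb, zero_mul, map_zero]) (by simp), Pi.single_eq_same,
    Pi.single_eq_same] at this
  exact this

theorem entry_conjOp_eq_zero (h : IsTwistSystem A u φ τ)
    (hW : ∀ P Q i j, matInner S W P Q i j = tform A u (rowOf i P) (conjRow (rowOf j Q)))
    {D : RightOp N} (hD : D ∈ weightAlgebra S W) {i j : Fin N} (hij : i ≠ j) (p : ℂ[X]) :
    entry (conjOp A D) i j p = 0 := by
  refine (isScalarDiffOp_entry (conjOp_mem_matDiffOps A hD.1) i j).eq_zero h.phi_ne_zero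
    (h.pos j) (h.pos i) (h.pearson j) (h.pearson i) (h.not_rational j i hij.symm)
    (fun q => ?_) p
  obtain ⟨n, hn⟩ := exists_mem_degLT (hat (coeffOp (twist (-A))) (Pi.single j q))
  obtain ⟨w, -, hw⟩ := h.exists_adjoint_entry hW hD j n q hn
  exact ⟨_, hw i⟩

theorem hat_conjOp_apply (h : IsTwistSystem A u φ τ)
    (hW : ∀ P Q i j, matInner S W P Q i j = tform A u (rowOf i P) (conjRow (rowOf j Q)))
    {D : RightOp N} (hD : D ∈ weightAlgebra S W) (v : Row N) (j : Fin N) :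
    hat (conjOp A D) v j = entry (conjOp A D) j j (v j) := by
  conv_lhs => rw [← Finset.univ_sum_single v]
  rw [map_sum, Finset.sum_apply]
  exact Finset.sum_eq_single j (fun b _ hb => h.entry_conjOp_eq_zero hW hD hb _) (by simp)

theorem hat_conjOp_single (h : IsTwistSystem A u φ τ)
    (hW : ∀ P Q i j, matInner S W P Q i j = tform A u (rowOf i P) (conjRow (rowOf j Q)))
    {D : RightOp N} (hD : D ∈ weightAlgebra S W) (i : Fin N) (p : ℂ[X]) :
    hat (conjOp A D) (Pi.single i p) = Pi.single i (entry (conjOp A D) i i p) := by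
  ext1 j
  rw [h.hat_conjOp_apply hW hD]
  by_cases hj : j = i
  · subst hj; rw [Pi.single_eq_same, Pi.single_eq_same]
  · rw [Pi.single_eq_of_ne hj, Pi.single_eq_of_ne hj, map_zero]

theorem hat_twist_single (B : Mat N) (i k : Fin N) (q : ℂ[X]) :
    hat (coeffOp (twist B)) (Pi.single i q) k = (Pi.single i q : Row N) k + X * (C (B i k) * q) := by
  rw [hat_twist, Finset.sum_eq_single i (fun b _ hb => by
    rw [Pi.single_eq_of_ne hb, mul_zero]) (by simp), Pi.single_eq_same]

/-- The vector `e_i q T⁻¹` has entries `q` and `-A i k x q`, so the shift `s` is `1` if row `i` of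
`A` is nonzero and `0` otherwise. It transfers degree bounds between row vectors and scalar
polynomials. -/
theorem exists_shift (h : IsTwistSystem A u φ τ) (i : Fin N) : ∃ s : ℕ, ∀ m q,
    hat (coeffOp (twist (-A))) (Pi.single i q) ∈ degLT N (m + s) ↔ q ∈ degreeLT ℂ m := by
  have hi : ∀ q, hat (coeffOp (twist (-A))) (Pi.single i q) i = q := fun q => by
    rw [hat_twist_single, Pi.single_eq_same, Matrix.neg_apply, h.diag_eq_zero, neg_zero, C_0,
      zero_mul, mul_zero, add_zero]
  have hk : ∀ k, k ≠ i → ∀ q, hat (coeffOp (twist (-A))) (Pi.single i q) k =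
      (-A i k) • (X * q) := fun k hk q => by
    rw [hat_twist_single, Pi.single_eq_of_ne hk, Matrix.neg_apply, zero_add, smul_eq_C_mul]
    ring
  by_cases hA : ∃ k, A i k ≠ 0
  · obtain ⟨k, hAk⟩ := hA
    have hki : k ≠ i := by
      rintro rfl; exact hAk (h.diag_eq_zero k)
    refine ⟨1, fun m q => ⟨fun hq => ?_, fun hq => ?_⟩⟩
    · have h1 := mem_degLT.1 hq k
      rw [hk k hki, Submodule.smul_mem_iff _ (neg_ne_zero.2 hAk)] at h1
      rw [mem_degreeLT_iff_coeff] at h1 ⊢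
      intro n hn
      have := h1 (n + 1) (by omega)
      rwa [coeff_X_mul] at this
    · rw [mem_degLT]
      intro j
      rw [mem_degreeLT_iff_coeff] at hq
      by_cases hj : j = i
      · subst hj
        rw [hi, mem_degreeLT_iff_coeff]
        exact fun n hn => hq n (by omega)
      · rw [hk j hj]
        refine Submodule.smul_mem _ _ (mem_degreeLT_iff_coeff.2 fun n hn => ?_)
        obtain ⟨n, rfl⟩ : ∃ l, n = l + 1 := ⟨n - 1, by omega⟩
        rw [coeff_X_mul]
        exact hq n (by omega)
  · push Not at hA
    refine ⟨0, fun m q => ?_⟩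
    rw [add_zero, mem_degLT]
    refine ⟨fun hq => by simpa only [hi] using hq i, fun hq j => ?_⟩
    by_cases hj : j = i
    · subst hj; rwa [hi]
    · rw [hk j hj, hA, neg_zero, zero_smul]; exact Submodule.zero_mem _

theorem entry_mem_degreeLT (h : IsTwistSystem A u φ τ)
    (hW : ∀ P Q i j, matInner S W P Q i j = tform A u (rowOf i P) (conjRow (rowOf j Q)))
    {D : RightOp N} (hD : D ∈ weightAlgebra S W) (i : Fin N) (n : ℕ) (p : ℂ[X])
    (hp : p ∈ degreeLT ℂ n) : entry (conjOp A D) i i p ∈ degreeLT ℂ n := by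
  obtain ⟨s, hs⟩ := h.exists_shift i
  have h1 := (hat_mem_degLT_and_exists_adjoint h.sq_eq_zero h.real h.pos hW hD _).1 _
    ((hs n p).2 hp)
  rw [h.hat_eq, hat_twist_twist_neg h.sq_eq_zero, h.hat_conjOp_single hW hD] at h1
  exact (hs _ _).1 h1

theorem exists_adjoint_entry_diag (h : IsTwistSystem A u φ τ)
    (hW : ∀ P Q i j, matInner S W P Q i j = tform A u (rowOf i P) (conjRow (rowOf j Q)))
    {D : RightOp N} (hD : D ∈ weightAlgebra S W) (i : Fin N) (n : ℕ) (q : ℂ[X])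
    (hq : q ∈ degreeLT ℂ n) :
    ∃ g ∈ degreeLT ℂ n, ∀ p, u i (entry (conjOp A D) i i p * q) = u i (p * g) := by
  obtain ⟨s, hs⟩ := h.exists_shift i
  obtain ⟨w, hw, hw'⟩ := h.exists_adjoint_entry hW hD i _ q ((hs n q).2 hq)
  refine ⟨hat (coeffOp (twist A)) w i, (hs _ _).1 ?_, hw' i⟩
  -- The other components of `w T` are adjoints of off-diagonal entries, which vanish; so `w = e_i g
  -- T⁻¹`, and the shift bounds the degree of `g`.
  have h1 : hat (coeffOp (twist A)) w = Pi.single i (hat (coeffOp (twist A)) w i) := by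
    ext1 j
    by_cases hj : j = i
    · subst hj; rw [Pi.single_eq_same]
    · rw [Pi.single_eq_of_ne hj]
      refine (h.pos j).eq_zero ?_
      rw [mul_comm, ← hw', h.entry_conjOp_eq_zero hW hD hj, zero_mul, map_zero]
  rw [← h1, hat_twist_neg_twist h.sq_eq_zero]
  exact hw

theorem entry_eq_smul (h : IsTwistSystem A u φ τ)
    (hW : ∀ P Q i j, matInner S W P Q i j = tform A u (rowOf i P) (conjRow (rowOf j Q)))
    {D : RightOp N} (hD : D ∈ weightAlgebra S W) (i : Fin N) {n : ℕ} {p : ℂ[X]}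
    (hp : X ^ n - p ∈ degreeLT ℂ n) (horth : ∀ q ∈ degreeLT ℂ n, u i (p * q) = 0) :
    entry (conjOp A D) i i p = (entry (conjOp A D) i i (X ^ n)).coeff n • p :=
  apply_eq_smul_of_orthogonal (h.pos i) (h.entry_mem_degreeLT hW hD i)
    (h.exists_adjoint_entry_diag hW hD i) hp horth

/-- Apply `D` to `e_i x ^ n`. Twisting, acting diagonally and untwisting puts `A i k (E_kk x ^ (n +
1) - x E_ii x ^ n)` in component `k`; since `D` preserves degrees, its coefficient of `x ^ (n + 1)`
is zero. -/
theorem coeff_entry_succ (h : IsTwistSystem A u φ τ)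
    (hW : ∀ P Q i j, matInner S W P Q i j = tform A u (rowOf i P) (conjRow (rowOf j Q)))
    {D : RightOp N} (hD : D ∈ weightAlgebra S W) {i k : Fin N} (hik : A i k ≠ 0) (n : ℕ) :
    (entry (conjOp A D) k k (X ^ (n + 1))).coeff (n + 1) =
      (entry (conjOp A D) i i (X ^ n)).coeff n := by
  have hki : k ≠ i := by
    rintro rfl; exact hik (h.diag_eq_zero k)
  have h1 : (Pi.single i (X ^ n) : Row N) ∈ degLT N (n + 1) := mem_degLT.2 fun j => by
    by_cases hj : j = i
    · subst hj; rw [Pi.single_eq_same]; exact X_pow_mem_degreeLT n.lt_succ_self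
    · rw [Pi.single_eq_of_ne hj]; exact Submodule.zero_mem _
  have h2 := mem_degLT_iff_coeff.1
    ((hat_mem_degLT_and_exists_adjoint h.sq_eq_zero h.real h.pos hW hD _).1 _ h1) k (n + 1) le_rfl
  rw [h.hat_eq, hat_twist, Finset.sum_eq_single i] at h2
  · rw [h.hat_conjOp_apply hW hD, h.hat_conjOp_apply hW hD, hat_twist_single, hat_twist_single,
      Pi.single_eq_same, Pi.single_eq_of_ne hki, h.diag_eq_zero, C_0, zero_mul, mul_zero, add_zero,
      zero_add, mul_left_comm, ← pow_succ', ← smul_eq_C_mul, map_smul, coeff_add, coeff_smul,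
      coeff_X_mul, coeff_C_mul, Matrix.neg_apply, smul_eq_mul, neg_mul, ← sub_eq_add_neg,
      ← mul_sub] at h2
    exact sub_eq_zero.1 ((_root_.mul_eq_zero.1 h2).resolve_left hik)
  -- Every product `A i b * A b k` vanishes separately, so no other intermediate index contributes.
  · intro b _ hb
    rw [h.hat_conjOp_apply hW hD, hat_twist_single, Pi.single_eq_of_ne hb, zero_add]
    rcases _root_.mul_eq_zero.1 (h.mul_eq_zero i b k) with h3 | h3
    · rw [h3, C_0, zero_mul, mul_zero, map_zero, mul_zero]
    · rw [Matrix.neg_apply, h3, neg_zero, C_0, zero_mul]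
  · simp

theorem eq_zero_of_entry_zero (h : IsTwistSystem A u φ τ)
    (hW : ∀ P Q i j, matInner S W P Q i j = tform A u (rowOf i P) (conjRow (rowOf j Q)))
    {D : RightOp N} (hD : D ∈ weightAlgebra S W) {q : ℕ → ℂ[X]}
    (hq : ∀ n, X ^ n - q n ∈ degreeLT ℂ n) (hDq : ∀ n, entry (conjOp A D) 0 0 (q n) = 0) :
    D = 0 := by
  have hpoly : ∀ e : ℂ[X], (∀ n : ℕ, e.eval ((n : ℂ) + 1) = 0) → e = 0 := fun e he =>
    eq_zero_of_infinite_isRoot _ ((Set.infinite_range_of_injective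
      (f := fun n : ℕ => (n : ℂ) + 1) (fun a b hab => by simpa using hab)).mono
      (by rintro _ ⟨n, rfl⟩; exact he n))
  have key : ∀ (m : ℕ) (i : Fin N), i.val = m → ∀ n,
      (entry (conjOp A D) i i (X ^ n)).coeff n = 0 := by
    intro m
    induction m with
    | zero =>
      intro i hi n
      obtain rfl : i = 0 := Fin.ext hi
      rw [eq_zero_of_forall_monic hq hDq, coeff_zero]
    | succ m ih =>
      intro i hi n
      have hj := ih ⟨m, by omega⟩ rfl
      rcases h.linked ⟨m, by omega⟩ i hi with hA | hA
      -- In this direction only the eigenvalues at `n + 1` are known to vanish. The one at `0`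
      -- follows because they are the values of a polynomial with infinitely many roots.
      · obtain ⟨e, he⟩ :=
          (isScalarDiffOp_entry (conjOp_mem_matDiffOps A hD.1) i i).exists_symbol
        have h0 : e = 0 := hpoly e fun n => by
          have := he (n + 1)
          push_cast at this
          rw [← this, h.coeff_entry_succ hW hD hA, hj]
        rw [he, h0, eval_zero]
      · rw [← h.coeff_entry_succ hW hD hA, hj]
  have hE : ∀ i p, entry (conjOp A D) i i p = 0 := fun i => by
    choose p hp horth using exists_monic_orthogonal (h.pos i)
    refine eq_zero_of_forall_monic hp fun n => ?_
    rw [h.entry_eq_smul hW hD i (hp n) (horth n), key _ i rfl, zero_smul]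
  refine eq_zero_of_hat fun v => ?_
  have h1 : hat (conjOp A D) (hat (coeffOp (twist A)) v) = 0 := by
    ext1 j
    rw [h.hat_conjOp_apply hW hD, hE]; rfl
  rw [h.hat_eq, h1, map_zero]

/-- The Pearson equation puts the form of the conjugated operator into the symmetric shape `-u_k(φ
p' q') + κ_k u_k(p q)`. -/
theorem mem_weightAlgebra (h : IsTwistSystem A u φ τ)
    (hW : ∀ P Q i j, matInner S W P Q i j = tform A u (rowOf i P) (conjRow (rowOf j Q)))
    {D₀ : RightOp N} (hD₀ : D₀ ∈ matDiffOps N) {κ : Fin N → ℂ}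
    (hconj : ∀ v j, hat (conjOp A D₀) v j =
      φ * derivative (derivative (v j)) + τ j * derivative (v j) + C (κ j) * v j)
    (hdeg : ∀ n, ∀ v ∈ degLT N n, hat D₀ v ∈ degLT N n) : D₀ ∈ weightAlgebra S W := by
  refine mem_weightAlgebra_of_symmetric h.sq_eq_zero h.real h.pos hW hD₀ hdeg fun v w => ?_
  have hs : ∀ k p q,
      u k ((φ * derivative (derivative p) + τ k * derivative p + C (κ k) * p) * q) =
        -u k (φ * derivative p * derivative q) + u k (C (κ k) * p * q) := fun k p q => by
    have e : φ * derivative p * derivative q = φ * derivative q * derivative p :=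
      mul_right_comm _ _ _
    rw [add_mul, map_add, e, (h.pearson k).apply_derivative_mul, neg_neg]
    congr 2
    ring
  simp only [tform_apply, h.hat_twist_hat, hconj]
  refine Finset.sum_congr rfl fun k _ => ?_
  generalize hat (coeffOp (twist A)) v k = p
  generalize hat (coeffOp (twist A)) w k = q
  rw [mul_comm p, hs, hs, mul_right_comm φ, mul_right_comm (C (κ k))]

/-- The vectors `v n = e_0 q_n T⁻¹` are common eigenvectors of the whole algebra. The hypothesis
`hsymb`, that eigenvalues at index `0` are polynomials in those of `D₀`, isolates what must be
proved for each family. -/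
theorem isPolynomialAlgebraIn (h : IsTwistSystem A u φ τ)
    (hW : ∀ P Q i j, matInner S W P Q i j = tform A u (rowOf i P) (conjRow (rowOf j Q)))
    {D₀ : RightOp N} (hD₀ : D₀ ∈ matDiffOps N) {κ : Fin N → ℂ}
    (hconj : ∀ v j, hat (conjOp A D₀) v j =
      φ * derivative (derivative (v j)) + τ j * derivative (v j) + C (κ j) * v j)
    (hdeg : ∀ n, ∀ v ∈ degLT N n, hat D₀ v ∈ degLT N n) (l : ℕ → ℂ)
    (hl : ∀ n, (φ * derivative (derivative (X ^ n)) + τ 0 * derivative (X ^ n) +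
      C (κ 0) * X ^ n).coeff n = l n) (hinj : Function.Injective l)
    (hsymb : ∀ (E : ℂ[X] →ₗ[ℂ] ℂ[X]), IsScalarDiffOp E → ∀ (q : ℕ → ℂ[X]) (e : ℕ → ℂ),
      (∀ n, X ^ n - q n ∈ degreeLT ℂ n) → (∀ n, E (q n) = e n • q n) →
      (∀ n, (E (X ^ n)).coeff n = e n) →
      (∀ n, φ * derivative (derivative (q n)) + τ 0 * derivative (q n) + C (κ 0) * q n
        = l n • q n) → ∃ P : ℂ[X], ∀ n, e n = P.eval (l n)) :
    IsPolynomialAlgebraIn (weightAlgebra S W) D₀ := by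
  have hmem := h.mem_weightAlgebra hW hD₀ hconj hdeg
  choose q hq horth using exists_monic_orthogonal (h.pos 0)
  let v : ℕ → Row N := fun n => hat (coeffOp (twist (-A))) (Pi.single 0 (q n))
  have hv : ∀ {D : RightOp N}, D ∈ weightAlgebra S W → ∀ n,
      hat D (v n) = (entry (conjOp A D) 0 0 (X ^ n)).coeff n • v n := fun {D} hD n => by
    rw [h.hat_eq, hat_twist_twist_neg h.sq_eq_zero, h.hat_conjOp_single hW hD,
      h.entry_eq_smul hW hD 0 (hq n) (horth n), Pi.single_smul, map_smul]
  have hv0 : ∀ n, v n ≠ 0 := fun n h0 => ne_zero_of_X_pow_sub_mem (hq n) <| by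
    have h1 := hat_twist_twist_neg h.sq_eq_zero (Pi.single 0 (q n))
    change hat _ (v n) = _ at h1
    rw [h0, map_zero] at h1
    simpa using congr_fun h1.symm 0
  have hl' : ∀ n, (entry (conjOp A D₀) 0 0 (X ^ n)).coeff n = l n := fun n => by
    rw [← hl, entry_apply, hconj, Pi.single_eq_same]
  have hv₀ : ∀ n, hat D₀ (v n) = l n • v n := fun n => by rw [hv hmem, hl']
  refine ⟨hmem, le_antisymm (fun D hD => ?_) (Algebra.adjoin_le (by simpa using hmem)), ?_⟩
  · obtain ⟨P, hP⟩ := hsymb (entry (conjOp A D) 0 0)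
      (isScalarDiffOp_entry (conjOp_mem_matDiffOps A hD.1) 0 0) q _ hq
      (fun n => h.entry_eq_smul hW hD 0 (hq n) (horth n)) (fun n => rfl) (fun n => by
        rw [← hl', ← h.entry_eq_smul hW hmem 0 (hq n) (horth n), entry_apply, hconj,
          Pi.single_eq_same])
    have hPD : ∀ Q : ℂ[X], aeval D₀ Q ∈ Algebra.adjoin ℂ {D₀} := fun Q =>
      aeval_mem_adjoin_singleton ℂ D₀
    have hPD' : aeval D₀ (-P) ∈ weightAlgebra S W :=
      Algebra.adjoin_le (by simpa using hmem) (hPD _)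
    have h0 : D + aeval D₀ (-P) = 0 := by
      refine h.eq_zero_of_entry_zero hW (add_mem hD hPD') hq fun n => ?_
      rw [entry_apply, hat_conjOp]
      change hat _ (hat _ (v n)) 0 = 0
      rw [hat_add, hat_aeval (hv₀ n), hv hD, hP, ← add_smul, eval_neg, add_neg_cancel, zero_smul,
        map_zero]
      rfl
    have h1 : D = aeval D₀ P := by
      calc D = D + aeval D₀ (-P + P) := by rw [neg_add_cancel, map_zero, add_zero]
        _ = D + aeval D₀ (-P) + aeval D₀ P := by rw [map_add, add_assoc]
        _ = aeval D₀ P := by rw [h0, zero_add]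
    rw [h1]
    exact hPD P
  · rw [transcendental_iff]
    intro P hP
    refine eq_zero_of_infinite_isRoot _ ((Set.infinite_range_of_injective hinj).mono ?_)
    rintro _ ⟨n, rfl⟩
    have h1 := hat_aeval (hv₀ n) P
    rw [hP, hat_zero] at h1
    exact (smul_eq_zero.1 h1.symm).resolve_right (hv0 n)

end IsTwistSystem

end conj

/-! ### Second-order operators and their conjugates -/

/-- `∂² (φ₀ + φ₁ x + φ₂ x²) + ∂ (M₀ + M₁ x) + M`. -/
def secondOrder {N : ℕ} (φ₀ φ₁ φ₂ : ℂ) (M₀ M₁ M : Mat N) : RightOp N :=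
  del N ^ 2 * coeffOp (C (φ₀ • 1) + C (φ₁ • 1) * X + C (φ₂ • 1) * X ^ 2) +
    del N * coeffOp (C M₀ + C M₁ * X) + coeffOp (C M)

theorem secondOrder_mem_matDiffOps {N : ℕ} (φ₀ φ₁ φ₂ : ℂ) (M₀ M₁ M : Mat N) :
    secondOrder φ₀ φ₁ φ₂ M₀ M₁ M ∈ matDiffOps N :=
  ⟨Finsupp.single 2 (C (φ₀ • 1) + C (φ₁ • 1) * X + C (φ₂ • 1) * X ^ 2) +
    Finsupp.single 1 (C M₀ + C M₁ * X) + Finsupp.single 0 (C M), by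
      rw [diffOp_add, diffOp_add, diffOp_single, diffOp_single, diffOp_single, pow_one, pow_zero,
        one_mul]; rfl⟩

theorem coeffOp_twist_mul_del {N : ℕ} (A : Mat N) :
    coeffOp (twist A) * del N = del N * coeffOp (twist A) + coeffOp (C A) := by
  rw [coeffOp_mul_del, twist, derivative_add, derivative_one, derivative_C_mul, derivative_X,
    zero_add, mul_one]

theorem coeffOp_twist_mul_del_sq {N : ℕ} (A : Mat N) :
    coeffOp (twist A) * del N ^ 2 =
      del N ^ 2 * coeffOp (twist A) + (del N * coeffOp (C A) + del N * coeffOp (C A)) := by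
  have h : coeffOp (C A) * del N = del N * coeffOp (C A) := by
    rw [coeffOp_mul_del, derivative_C, coeffOp_zero, add_zero]
  rw [pow_two, ← mul_assoc, coeffOp_twist_mul_del, add_mul, mul_assoc, coeffOp_twist_mul_del, h,
    mul_add, mul_assoc, add_assoc]

theorem C_add_C_mul_X_mul_twist {N : ℕ} (M₀ M₁ A : Mat N) :
    (C M₀ + C M₁ * X) * twist A = C M₀ + C (M₁ + M₀ * A) * X + C (M₁ * A) * X ^ 2 := by
  rw [twist, mul_add, mul_one, add_mul, ← mul_assoc, ← C_mul, mul_assoc (C M₁), ← mul_assoc X, X_mul,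
    mul_assoc (C A), ← mul_assoc (C M₁), ← C_mul, ← pow_two, C_add, add_mul]
  abel

theorem twist_mul_C_add_C_mul_X {N : ℕ} (t₀ t₁ A : Mat N) :
    twist A * (C t₀ + C t₁ * X) = C t₀ + C (t₁ + A * t₀) * X + C (A * t₁) * X ^ 2 := by
  rw [twist, add_mul, one_mul, mul_add, mul_assoc (C A), X_mul, ← mul_assoc, ← C_mul,
    mul_assoc (C A), ← mul_assoc X, X_mul, mul_assoc (C t₁), ← mul_assoc (C A), ← C_mul, ← pow_two,
    C_add, add_mul]
  abel

/-- With `T ∂ = ∂ T + A` and `T ∂² = ∂² T + 2 ∂ A`, the intertwining relation is compared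
coefficientwise: `h₀`, `h₁`, `h₂` are the powers `1, x, x²` next to `∂`, and `h₃`, `h₄` the powers
`1, x` in order zero. -/
theorem secondOrder_mul_coeffOp_twist {N : ℕ} {φ₀ φ₁ φ₂ : ℂ} {M₀ M₁ M t₀ t₁ κ A : Mat N}
    (h₀ : M₀ = (2 * φ₀) • A + t₀) (h₁ : M₁ + M₀ * A = (2 * φ₁) • A + (t₁ + A * t₀))
    (h₂ : M₁ * A = (2 * φ₂) • A + A * t₁) (h₃ : M = A * t₀ + κ) (h₄ : M * A = A * t₁ + A * κ) :
    secondOrder φ₀ φ₁ φ₂ M₀ M₁ M * coeffOp (twist A) =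
      coeffOp (twist A) * secondOrder φ₀ φ₁ φ₂ t₀ t₁ κ := by
  have hc : ∀ (c : ℂ) (B : Mat N), C (c • (1 : Mat N)) * C B = C (c • B) := fun c B => by
    rw [← C_mul, smul_mul_assoc, one_mul]
  have hc' : ∀ (c : ℂ) (B : Mat N), C B * C (c • (1 : Mat N)) = C (c • B) := fun c B => by
    rw [← C_mul, mul_smul_comm, mul_one]
  rw [secondOrder, secondOrder]
  obtain ⟨Φ, hΦ⟩ : ∃ Φ : MatPoly N,
    Φ = C (φ₀ • 1) + C (φ₁ • 1) * X + C (φ₂ • 1) * X ^ 2 := ⟨_, rfl⟩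
  have hΦC : Φ * C A = C A * Φ := by
    rw [hΦ, add_mul, add_mul, mul_add, mul_add, mul_assoc, X_mul_C, mul_assoc, X_pow_mul_C,
      ← mul_assoc, ← mul_assoc, ← mul_assoc, ← mul_assoc, hc, hc, hc, hc', hc', hc']
  have hΦT : Φ * twist A = twist A * Φ := by
    rw [twist, mul_add, add_mul, mul_one, one_mul, ← mul_assoc, hΦC, mul_assoc, ← X_mul, mul_assoc]
  have hF1 : (C M₀ + C M₁ * X) * twist A = C A * Φ + C A * Φ + twist A * (C t₀ + C t₁ * X) := by
    rw [C_add_C_mul_X_mul_twist, twist_mul_C_add_C_mul_X, h₁, h₂, h₀, hΦ, mul_add, mul_add,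
      ← mul_assoc, ← mul_assoc, hc', hc', hc', two_mul, two_mul, two_mul, add_smul, add_smul,
      add_smul]
    simp only [C_add, add_mul]
    abel
  have hF0 : C M * twist A = C A * (C t₀ + C t₁ * X) + twist A * C κ := by
    rw [twist, mul_add, mul_one, ← mul_assoc, ← C_mul, h₄, h₃, mul_add, add_mul, one_mul,
      mul_assoc (C A) X, X_mul_C, ← mul_assoc, ← mul_assoc, ← C_mul, ← C_mul, ← C_mul, C_add,
      C_add, add_mul]
    abel
  rw [← hΦ, add_mul, add_mul, mul_assoc, mul_assoc, ← coeffOp_mul, ← coeffOp_mul, ← coeffOp_mul,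
    hΦT, hF1, hF0, mul_add (coeffOp (twist A)), mul_add (coeffOp (twist A)), ← mul_assoc,
    coeffOp_twist_mul_del_sq, ← mul_assoc (coeffOp (twist A)), coeffOp_twist_mul_del,
    ← coeffOp_mul]
  simp only [coeffOp_add, coeffOp_mul, mul_add, add_mul, mul_assoc]
  abel

section hat
variable {N : ℕ} [NeZero N]

theorem hat_del_pow_mul_coeffOp (k l : ℕ) (M : Mat N) (v : Row N) (j : Fin N) :
    hat (del N ^ k * coeffOp (C M * X ^ l)) v j =
      ∑ i, derivative^[k] (v i) * (C (M i j) * X ^ l) := by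
  have h : ∀ i, rowOf i (C M * X ^ l : MatPoly N) j = C (M i j) * X ^ l := fun i => by
    induction l with
    | zero => rw [pow_zero, mul_one, rowOf_C, pow_zero, mul_one]
    | succ l ih => rw [pow_succ, ← mul_assoc, rowOf_mul_X, ih, pow_succ, mul_assoc]
  rw [hat_mul, hat_coeffOp]
  exact Finset.sum_congr rfl fun i _ => by rw [hat_del_pow, h]

omit [NeZero N] in
theorem secondOrder_eq (φ₀ φ₁ φ₂ : ℂ) (M₀ M₁ M : Mat N) :
    secondOrder φ₀ φ₁ φ₂ M₀ M₁ M =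
      del N ^ 2 * coeffOp (C (φ₀ • 1) * X ^ 0) + del N ^ 2 * coeffOp (C (φ₁ • 1) * X ^ 1) +
        del N ^ 2 * coeffOp (C (φ₂ • 1) * X ^ 2) +
      (del N ^ 1 * coeffOp (C M₀ * X ^ 0) + del N ^ 1 * coeffOp (C M₁ * X ^ 1)) +
      del N ^ 0 * coeffOp (C M * X ^ 0) := by
  simp only [secondOrder, pow_zero, pow_one, mul_one, one_mul, coeffOp_add, mul_add]

theorem hat_secondOrder_diagonal (φ₀ φ₁ φ₂ : ℂ) (t₀ t₁ κ : Fin N → ℂ) (v : Row N) (j : Fin N) :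
    hat (secondOrder φ₀ φ₁ φ₂ (Matrix.diagonal t₀) (Matrix.diagonal t₁) (Matrix.diagonal κ)) v j =
      (C φ₀ + C φ₁ * X + C φ₂ * X ^ 2) * derivative (derivative (v j)) +
        (C (t₀ j) + C (t₁ j) * X) * derivative (v j) + C (κ j) * v j := by
  have h : ∀ (k l : ℕ) (t : Fin N → ℂ),
      hat (del N ^ k * coeffOp (C (Matrix.diagonal t) * X ^ l)) v j =
        derivative^[k] (v j) * (C (t j) * X ^ l) := fun k l t => by
    rw [hat_del_pow_mul_coeffOp, Finset.sum_eq_single j (fun b _ hb => by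
      rw [Matrix.diagonal_apply_ne _ hb, C_0, zero_mul, mul_zero]) (by simp),
      Matrix.diagonal_apply_eq]
  rw [secondOrder_eq]
  simp only [Matrix.smul_one_eq_diagonal, hat_add, Pi.add_apply, h, Function.iterate_succ_apply',
    Function.iterate_zero_apply]
  ring

theorem hat_del_pow_mul_coeffOp_mem {k l : ℕ} (hlk : l ≤ k) (M : Mat N) {n : ℕ} {v : Row N}
    (hv : v ∈ degLT N n) : hat (del N ^ k * coeffOp (C M * X ^ l)) v ∈ degLT N n := by
  rw [mem_degLT_iff_coeff] at hv ⊢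
  intro j m hm
  rw [hat_del_pow_mul_coeffOp, finsetSum_coeff]
  refine Finset.sum_eq_zero fun i _ => ?_
  rw [← mul_assoc, coeff_mul_X_pow']
  split_ifs with h
  · rw [coeff_mul_C, coeff_iterate_derivative, hv i _ (by omega), smul_zero, zero_mul]
  · rfl

theorem hat_secondOrder_mem (φ₀ φ₁ φ₂ : ℂ) (M₀ M₁ M : Mat N) (n : ℕ) (v : Row N)
    (hv : v ∈ degLT N n) : hat (secondOrder φ₀ φ₁ φ₂ M₀ M₁ M) v ∈ degLT N n := by
  rw [secondOrder_eq]
  simp only [hat_add]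
  have h := fun {k l : ℕ} (hlk : l ≤ k) (M : Mat N) => hat_del_pow_mul_coeffOp_mem hlk M hv
  exact add_mem (add_mem (add_mem (add_mem (h (by norm_num) _) (h (by norm_num) _))
    (h le_rfl _)) (add_mem (h (by norm_num) _) (h le_rfl _))) (h le_rfl _)

theorem hat_conjOp_secondOrder {φ₀ φ₁ φ₂ : ℂ} {A : Mat N} (hA : A * A = 0) {M₀ M₁ M : Mat N}
    {t₀ t₁ κ : Fin N → ℂ} (h₀ : M₀ = (2 * φ₀) • A + Matrix.diagonal t₀)
    (h₁ : M₁ + M₀ * A = (2 * φ₁) • A + (Matrix.diagonal t₁ + A * Matrix.diagonal t₀))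
    (h₂ : M₁ * A = (2 * φ₂) • A + A * Matrix.diagonal t₁)
    (h₃ : M = A * Matrix.diagonal t₀ + Matrix.diagonal κ)
    (h₄ : M * A = A * Matrix.diagonal t₁ + A * Matrix.diagonal κ) (v : Row N) (j : Fin N) :
    hat (conjOp A (secondOrder φ₀ φ₁ φ₂ M₀ M₁ M)) v j =
      (C φ₀ + C φ₁ * X + C φ₂ * X ^ 2) * derivative (derivative (v j)) +
        (C (t₀ j) + C (t₁ j) * X) * derivative (v j) + C (κ j) * v j := by
  rw [conjOp, mul_assoc, secondOrder_mul_coeffOp_twist h₀ h₁ h₂ h₃ h₄, hat_mul, hat_mul,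
    hat_twist_twist_neg hA, hat_secondOrder_diagonal]

/-! ### The matrices `A` and `K` -/

omit [NeZero N] in
-- This support in even rows and odd columns (counted from `0`) is behind all the relations used:
-- `A² = 0`, `A d A = 0` for diagonal `d`, `A K = A` and `K A = 0`.
theorem even_odd_of_matA_ne_zero {a : ℕ → ℝ} {i k : Fin N} (h : matA N a i k ≠ 0) :
    Even i.val ∧ Odd k.val := by
  unfold matA at h
  split_ifs at h with h1 h2
  · exact ⟨h1.1, by rw [h1.2]; exact h1.1.add_one⟩
  · refine ⟨h2.1, ?_⟩
    have := h2.1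
    rw [h2.2] at this
    exact Nat.not_even_iff_odd.1 (fun hk => by simp [Nat.even_add_one, hk] at this)
  · exact absurd rfl h

omit [NeZero N] in
theorem matA_mul_matA_apply (a : ℕ → ℝ) (i j k : Fin N) : matA N a i j * matA N a j k = 0 := by
  by_contra h
  exact Nat.not_even_iff_odd.2 (even_odd_of_matA_ne_zero (left_ne_zero_of_mul h)).2
    (even_odd_of_matA_ne_zero (right_ne_zero_of_mul h)).1

omit [NeZero N] in
theorem matA_real (a : ℕ → ℝ) (i j : Fin N) : starRingEnd ℂ (matA N a i j) = matA N a i j := by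
  unfold matA
  split_ifs <;> simp

omit [NeZero N] in
theorem matA_linked {a : ℕ → ℝ} (ha : ∀ k, 1 ≤ k → k < N → a k ≠ 0) (i j : Fin N)
    (hij : j.val = i.val + 1) : matA N a i j ≠ 0 ∨ matA N a j i ≠ 0 := by
  have h := ha j.val (by omega) j.isLt
  rcases Nat.even_or_odd i.val with he | ho
  · left
    unfold matA
    rw [if_pos ⟨he, hij⟩, ← hij]
    exact_mod_cast h
  · right
    unfold matA
    rw [if_neg (by omega), if_pos ⟨by rw [hij]; exact ho.add_one, hij⟩]
    exact_mod_cast h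

omit [NeZero N] in
theorem matA_mul_matA (a : ℕ → ℝ) : matA N a * matA N a = 0 := by
  ext i k
  rw [Matrix.mul_apply]
  exact Finset.sum_eq_zero fun j _ => matA_mul_matA_apply a i j k

omit [NeZero N] in
theorem matA_mul_diagonal_mul_matA (a : ℕ → ℝ) (d : Fin N → ℂ) :
    matA N a * Matrix.diagonal d * matA N a = 0 := by
  ext i k
  rw [Matrix.mul_apply]
  refine Finset.sum_eq_zero fun j _ => ?_
  rw [Matrix.mul_diagonal, mul_right_comm, matA_mul_matA_apply, zero_mul]

omit [NeZero N] in
theorem matA_mul_matK (a : ℕ → ℝ) : matA N a * matK N = matA N a := by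
  ext i k
  rw [matK, Matrix.mul_diagonal]
  by_cases h : matA N a i k = 0
  · rw [h, zero_mul]
  · rw [if_pos (even_odd_of_matA_ne_zero h).2, mul_one]

omit [NeZero N] in
theorem matK_mul_matA (a : ℕ → ℝ) : matK N * matA N a = 0 := by
  ext i k
  rw [matK, Matrix.diagonal_mul, Matrix.zero_apply]
  by_cases h : matA N a i k = 0
  · rw [h, mul_zero]
  · rw [if_neg (Nat.not_odd_iff_even.2 (even_odd_of_matA_ne_zero h).1), zero_mul]

end hat

open MeasureTheory

/-! ### Moment functionals of weights -/

/-- All polynomials are integrable against the weight `w` on `S`. -/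
def HasMoments (S : Set ℝ) (w : ℝ → ℝ) : Prop :=
  ∀ p : ℂ[X], IntegrableOn (fun x : ℝ => p.eval (x : ℂ) * (w x : ℂ)) S

theorem HasMoments.of_pow {S : Set ℝ} {w : ℝ → ℝ}
    (h : ∀ n : ℕ, IntegrableOn (fun x : ℝ => x ^ n * w x) S) : HasMoments S w := by
  intro p
  induction p using Polynomial.induction_on' with
  | add p q hp hq =>
    simp only [eval_add, add_mul]
    exact hp.add hq
  | monomial n c =>
    have h1 : IntegrableOn (fun x : ℝ => c * ((x ^ n * w x : ℝ) : ℂ)) S :=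
      (h n).ofReal.const_mul c
    refine h1.congr (ae_of_all _ fun x => ?_)
    simp only [eval_monomial]
    push_cast
    ring

/-- `p ↦ ∫_S p(x) w(x) dx`. -/
def moment {S : Set ℝ} {w : ℝ → ℝ} (h : HasMoments S w) : ℂ[X] →ₗ[ℂ] ℂ where
  toFun p := ∫ x in S, p.eval (x : ℂ) * (w x : ℂ)
  map_add' p q := by
    rw [← integral_add (h p) (h q)]
    simp only [eval_add, add_mul]
  map_smul' c p := by
    rw [RingHom.id_apply, smul_eq_mul, ← integral_const_mul]
    simp only [eval_smul, smul_eq_mul, mul_assoc]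

theorem moment_apply {S : Set ℝ} {w : ℝ → ℝ} (h : HasMoments S w) (p : ℂ[X]) :
    moment h p = ∫ x in S, p.eval (x : ℂ) * (w x : ℂ) := rfl

theorem eval_conjPoly (p : ℂ[X]) (x : ℝ) :
    (conjPoly p).eval (x : ℂ) = starRingEnd ℂ (p.eval (x : ℂ)) := by
  have h := eval₂_at_apply (p := p) (starRingEnd ℂ) (x : ℂ)
  rw [Complex.conj_ofReal] at h
  rw [← h, conjPoly, coe_mapRingHom, eval_map]

theorem isPositiveMoment_moment {S : Set ℝ} {w : ℝ → ℝ} (h : HasMoments S w)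
    (hS : MeasurableSet S) (hS0 : volume S ≠ 0) (hw : ∀ x ∈ S, 0 < w x) :
    IsPositiveMoment (moment h) where
  conj p := by
    rw [moment_apply, moment_apply, ← integral_conj]
    simp only [eval_conjPoly, map_mul, Complex.conj_ofReal]
  pos p hp := by
    have he : ∀ x : ℝ, (p * conjPoly p).eval (x : ℂ) * (w x : ℂ) =
        ((Complex.normSq (p.eval (x : ℂ)) * w x : ℝ) : ℂ) := fun x => by
      rw [eval_mul, eval_conjPoly, Complex.mul_conj]
      push_cast
      rfl
    have hi := h (p * conjPoly p)
    simp only [he] at hi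
    have hi' : IntegrableOn (fun x : ℝ => Complex.normSq (p.eval (x : ℂ)) * w x) S := by
      simpa [IntegrableOn] using hi.re
    rw [moment_apply]
    simp only [he]
    rw [show (∫ x in S, ((Complex.normSq (p.eval (x : ℂ)) * w x : ℝ) : ℂ)) =
      ((∫ x in S, Complex.normSq (p.eval (x : ℂ)) * w x : ℝ) : ℂ) from integral_ofReal,
      Complex.ofReal_re, setIntegral_pos_iff_support_of_nonneg_ae _ hi']
    · let Z : Set ℝ := (fun x : ℝ => (x : ℂ)) ⁻¹' {z | p.IsRoot z}
      have hZ : Z.Finite :=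
        (finite_setOfPred_isRoot hp).preimage Complex.ofReal_injective.injOn
      refine (pos_iff_ne_zero.2 hS0).trans_le ?_
      rw [← measure_sdiff_null (s := S) (hZ.measure_zero volume)]
      refine measure_mono fun x hx => ⟨?_, hx.1⟩
      exact mul_ne_zero (fun h0 => hx.2 (Complex.normSq_eq_zero.1 h0)) (hw x hx.1).ne'
    · rw [Filter.EventuallyLE, ae_restrict_iff' hS]
      exact ae_of_all _ fun x hx => mul_nonneg (Complex.normSq_nonneg _) (hw x hx).le

theorem evalAt_apply {N : ℕ} (P : MatPoly N) (x : ℝ) (i j : Fin N) :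
    evalAt P x i j = (rowOf i P j).eval (x : ℂ) := by
  rw [evalAt, ← matPolyEquiv_symm_map_eval]; rfl

theorem matInner_twistedWeight {N : ℕ} [NeZero N] {S : Set ℝ} (a : ℕ → ℝ) {w : Fin N → ℝ → ℝ}
    (h : ∀ i, HasMoments S (w i)) (P Q : MatPoly N) (i j : Fin N) :
    matInner S (twistedWeight a w) P Q i j =
      tform (matA N a) (fun k => moment (h k)) (rowOf i P) (conjRow (rowOf j Q)) := by
  have hT : ∀ (P : MatPoly N) (x : ℝ) (i k : Fin N),
      (evalAt P x * (1 + (x : ℂ) • matA N a)) i k =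
        (hat (coeffOp (twist (matA N a))) (rowOf i P) k).eval (x : ℂ) := fun P x i k => by
    rw [mul_add, mul_one, mul_smul_comm, Matrix.add_apply, Matrix.smul_apply, Matrix.mul_apply,
      hat_twist, eval_add, eval_mul, eval_X, eval_finsetSum, evalAt_apply, smul_eq_mul]
    simp only [evalAt_apply, eval_mul, eval_C, mul_comm]
  rw [tform_apply]
  simp only [moment_apply]
  rw [← integral_finsetSum _ fun k _ => h k _]
  change ∫ x in S, _ = _
  congr 1
  ext x
  rw [twistedWeight, ← mul_assoc, ← mul_assoc, mul_assoc, ← Matrix.conjTranspose_mul,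
    Matrix.mul_apply]
  refine Finset.sum_congr rfl fun k _ => ?_
  rw [Matrix.mul_diagonal, Matrix.conjTranspose_apply, hT, hT, hat_twist_conjRow (matA_real a),
    eval_mul, conjRow, eval_conjPoly]
  exact mul_right_comm _ _ _

/-! ### The scalar weights -/

theorem hasDerivAt_eval_ofReal (p : ℂ[X]) (x : ℝ) :
    HasDerivAt (fun y : ℝ => p.eval (y : ℂ)) ((derivative p).eval (x : ℂ)) x :=
  (p.hasDerivAt (x : ℂ)).comp_ofReal

theorem hasMoments_hermite (b : ℝ) :
    HasMoments Set.univ fun x => Real.exp (-x ^ 2 + 2 * b * x) := by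
  have h0 : HasMoments Set.univ fun x => Real.exp (-x ^ 2) := by
    refine .of_pow fun n => ?_
    have := integrable_rpow_mul_exp_neg_mul_sq one_pos (s := n)
      (by have : (0 : ℝ) ≤ n := n.cast_nonneg
          linarith)
    simpa [Real.rpow_natCast] using this
  intro p
  rw [integrableOn_univ]
  -- Completing the square, the weight is `e^{b²}` times a Gaussian centred at `b`.
  have h1 := h0 (p.comp (X + C (b : ℂ)))
  rw [integrableOn_univ] at h1
  refine ((h1.comp_sub_right b).const_mul (Real.exp (b ^ 2) : ℂ)).congr (ae_of_all _ fun x => ?_)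
  simp only [eval_comp, eval_add, eval_X, eval_C]
  rw [Complex.ofReal_sub, sub_add_cancel, mul_left_comm, ← Complex.ofReal_mul, ← Real.exp_add]
  congr 3
  ring

theorem isPearson_hermite (b : ℝ) :
    IsPearson (moment (hasMoments_hermite b)) 1 (C (2 * (b : ℂ)) + C (-2) * X) := by
  intro p
  rw [moment_apply, Measure.restrict_univ]
  have h1 := hasMoments_hermite b p
  have h2 := hasMoments_hermite b (1 * derivative p + (C (2 * (b : ℂ)) + C (-2) * X) * p)
  rw [integrableOn_univ] at h1 h2
  refine integral_eq_zero_of_hasDerivAt_of_integrable (fun x => ?_) h2 h1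
  have h3 : HasDerivAt (fun y : ℝ => -y ^ 2 + 2 * b * y) (-(2 * x) + 2 * b) x := by
    exact (((hasDerivAt_pow 2 x).neg).add ((hasDerivAt_id x).const_mul (2 * b))).congr_deriv
      (by simp)
  refine ((hasDerivAt_eval_ofReal p x).mul h3.exp.ofReal_comp).congr_deriv ?_
  simp only [eval_add, eval_mul, eval_one, eval_C, eval_X]
  push_cast
  ring

theorem pow_mul_laguerre {α x : ℝ} (hx : 0 < x) (n : ℕ) :
    x ^ n * (Real.exp (-x) * x ^ α) = Real.exp (-x) * x ^ ((n + α + 1) - 1) := by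
  rw [add_sub_cancel_right, Real.rpow_add hx, Real.rpow_natCast]
  ring

theorem hasMoments_laguerre {α : ℝ} (hα : -1 < α) :
    HasMoments (Set.Ioi 0) fun x => Real.exp (-x) * x ^ α := by
  refine .of_pow fun n => ?_
  have hn : (0 : ℝ) ≤ n := n.cast_nonneg
  refine (Real.GammaIntegral_convergent (s := n + α + 1) (by linarith)).congr_fun
    (fun x hx => (pow_mul_laguerre hx n).symm) measurableSet_Ioi

theorem moment_laguerre_X_pow {α : ℝ} (hα : -1 < α) (n : ℕ) :
    moment (hasMoments_laguerre hα) (X ^ n) = (Real.Gamma (n + α + 1) : ℂ) := by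
  have hn : (0 : ℝ) ≤ n := n.cast_nonneg
  rw [Real.Gamma_eq_integral (by linarith), moment_apply]
  refine Eq.trans ?_ integral_ofReal
  refine setIntegral_congr_fun measurableSet_Ioi fun x hx => ?_
  simp only [eval_pow, eval_X, ← Complex.ofReal_pow, ← Complex.ofReal_mul]
  rw [pow_mul_laguerre hx]; rfl

/-- On monomials this is the functional equation `Γ(s + 1) = s Γ(s)` with `s = n + α + 1`. -/
theorem isPearson_laguerre {α : ℝ} (hα : -1 < α) :
    IsPearson (moment (hasMoments_laguerre hα)) X (C ((α : ℂ) + 1) + C (-1) * X) := by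
  intro p
  induction p using Polynomial.induction_on' with
  | add p q hp hq =>
    rw [derivative_add, mul_add, mul_add, add_add_add_comm, map_add, hp, hq, add_zero]
  | monomial n c =>
    have hn : (0 : ℝ) ≤ n := n.cast_nonneg
    have h : X * derivative (monomial n c) + (C ((α : ℂ) + 1) + C (-1) * X) * monomial n c =
        c • (((n + α + 1 : ℝ) : ℂ) • X ^ n - X ^ (n + 1)) := by
      rw [← C_mul_X_pow_eq_monomial, derivative_C_mul_X_pow, smul_eq_C_mul, smul_eq_C_mul]
      cases n with
      | zero => simp; ring
      | succ n => simp; ring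
    rw [h, map_smul, map_sub, map_smul, moment_laguerre_X_pow hα, moment_laguerre_X_pow hα]
    have h2 : ((n + 1 : ℕ) : ℝ) + α + 1 = (n + α + 1) + 1 := by push_cast; ring
    rw [h2, Real.Gamma_add_one (s := n + α + 1) (by linarith), smul_eq_mul, smul_eq_mul,
      Complex.ofReal_mul, sub_self, mul_zero]

theorem hasMoments_jacobi {α β : ℝ} (hα : -1 < α) (hβ : -1 < β) :
    HasMoments (Set.Ioo (-1) 1) fun x => (1 - x) ^ α * (1 + x) ^ β := by
  -- Splitting at `0` leaves one possibly singular factor on each half.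
  have h1 : IntervalIntegrable (fun x : ℝ => (1 - x) ^ α * (1 + x) ^ β) volume (-1) 0 := by
    have h := (intervalIntegral.intervalIntegrable_rpow' (a := 0) (b := 1) hβ).comp_add_left 1
    norm_num at h
    refine h.continuousOn_mul fun x hx => ContinuousAt.continuousWithinAt ?_
    rw [Set.uIcc_of_le (by norm_num)] at hx
    exact (continuousAt_const.sub continuousAt_id).rpow_const
      (Or.inl (by have := hx.2; exact ne_of_gt (by linarith) : (1 : ℝ) - x ≠ 0))
  have h2 : IntervalIntegrable (fun x : ℝ => (1 - x) ^ α * (1 + x) ^ β) volume 0 1 := by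
    have h := (intervalIntegral.intervalIntegrable_rpow' (a := 1) (b := 0) hα).comp_sub_left 1
    norm_num at h
    refine h.mul_continuousOn fun x hx => ContinuousAt.continuousWithinAt ?_
    rw [Set.uIcc_of_le (by norm_num)] at hx
    exact (continuousAt_const.add continuousAt_id).rpow_const
      (Or.inl (by have := hx.1; exact ne_of_gt (by linarith) : (1 : ℝ) + x ≠ 0))
  have h3 := h1.trans h2
  refine .of_pow fun n => ?_
  have h4 := h3.continuousOn_mul (continuous_pow n).continuousOn
  rw [intervalIntegrable_iff_integrableOn_Ioo_of_le (by norm_num)] at h4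
  exact h4

/-- The integrand is the derivative of `p φ w`, which is continuous up to both endpoints and
vanishes there because `α + 1` and `β + 1` are positive. -/
theorem isPearson_jacobi {α β : ℝ} (hα : -1 < α) (hβ : -1 < β) :
    IsPearson (moment (hasMoments_jacobi hα hβ)) (1 - X ^ 2)
      (C ((β : ℂ) - α) + C (-((α : ℂ) + β + 2)) * X) := by
  intro p
  have hi := hasMoments_jacobi hα hβ
    ((1 - X ^ 2) * derivative p + (C ((β : ℂ) - α) + C (-((α : ℂ) + β + 2)) * X) * p)
  rw [moment_apply, ← integral_Ioc_eq_integral_Ioo,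
    ← intervalIntegral.integral_of_le (by norm_num)]
  rw [← intervalIntegrable_iff_integrableOn_Ioo_of_le (by norm_num)] at hi
  have hd : ∀ x ∈ Set.Ioo (-1 : ℝ) 1,
      HasDerivAt (fun y : ℝ => p.eval (y : ℂ) * (((1 - y) ^ (α + 1) * (1 + y) ^ (β + 1) : ℝ) : ℂ))
        (((1 - X ^ 2) * derivative p + (C ((β : ℂ) - α) + C (-((α : ℂ) + β + 2)) * X) * p).eval
          (x : ℂ) * (((1 - x) ^ α * (1 + x) ^ β : ℝ) : ℂ)) x := fun x hx => by
    have hx1 : 0 < 1 - x := by linarith [hx.2]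
    have hx2 : 0 < 1 + x := by linarith [hx.1]
    have h1 := ((hasDerivAt_id x).const_sub 1).rpow_const (p := α + 1) (Or.inl hx1.ne')
    have h2 := ((hasDerivAt_id x).const_add 1).rpow_const (p := β + 1) (Or.inl hx2.ne')
    refine ((hasDerivAt_eval_ofReal p x).mul (h1.mul h2).ofReal_comp).congr_deriv ?_
    simp only [id, Pi.mul_apply, add_sub_cancel_right, Real.rpow_add_one hx1.ne',
      Real.rpow_add_one hx2.ne',
      eval_add, eval_sub, eval_mul, eval_one, eval_pow, eval_C, eval_X]
    push_cast
    ring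
  have hc : ContinuousOn (fun y : ℝ => p.eval (y : ℂ) *
      (((1 - y) ^ (α + 1) * (1 + y) ^ (β + 1) : ℝ) : ℂ)) (Set.Icc (-1) 1) := by
    refine Continuous.continuousOn (Continuous.mul ?_ (Complex.continuous_ofReal.comp
      (Continuous.mul ?_ ?_)))
    · exact p.continuous.comp Complex.continuous_ofReal
    · exact (continuous_const.sub continuous_id).rpow_const fun x => Or.inr (by linarith)
    · exact (continuous_const.add continuous_id).rpow_const fun x => Or.inr (by linarith)
  rw [intervalIntegral.integral_eq_sub_of_hasDerivAt_of_le (by norm_num) hc hd hi]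
  simp [Real.zero_rpow (show α + 1 ≠ 0 by linarith), Real.zero_rpow (show β + 1 ≠ 0 by linarith)]

/-! ### The criterion for second-order operators and its three applications -/

section final
variable {N : ℕ} [NeZero N]

theorem coeff_secondOrder_X_pow (φ₀ φ₁ φ₂ t₀ t₁ κ : ℂ) (n : ℕ) :
    ((C φ₀ + C φ₁ * X + C φ₂ * X ^ 2) * derivative (derivative (X ^ n)) +
      (C t₀ + C t₁ * X) * derivative (X ^ n) + C κ * X ^ n).coeff n =
      φ₂ * n * (n - 1) + t₁ * n + κ := by
  rcases n with _ | _ | n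
  · simp
  · simp
  · have h : (C φ₀ + C φ₁ * X + C φ₂ * X ^ 2) * derivative (derivative (X ^ (n + 2))) +
      (C t₀ + C t₁ * X) * derivative (X ^ (n + 2)) + C κ * X ^ (n + 2) =
      C (φ₀ * (n + 2) * (n + 1)) * X ^ n + C (φ₁ * (n + 2) * (n + 1) + t₀ * (n + 2)) * X ^ (n + 1) +
        C (φ₂ * (n + 2) * (n + 1) + t₁ * (n + 2) + κ) * X ^ (n + 2) := by
      simp
      rw [show (C (2 : ℂ) : ℂ[X]) = 2 from map_ofNat C 2]
      ring
    rw [h]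
    simp only [coeff_add, coeff_C_mul_X_pow]
    rw [if_neg (by omega), if_neg (by omega), if_pos trivial]
    push_cast
    ring

theorem IsTwistSystem.isPolynomialAlgebraIn_secondOrder {A : Mat N}
    {u : Fin N → ℂ[X] →ₗ[ℂ] ℂ} {S : Set ℝ} {W : ℝ → Mat N} {φ₀ φ₁ φ₂ : ℂ}
    {M₀ M₁ M : Mat N} {t₀ t₁ κ : Fin N → ℂ}
    (h : IsTwistSystem A u (C φ₀ + C φ₁ * X + C φ₂ * X ^ 2) fun j => C (t₀ j) + C (t₁ j) * X)
    (hW : ∀ P Q i j, matInner S W P Q i j = tform A u (rowOf i P) (conjRow (rowOf j Q)))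
    (h₀ : M₀ = (2 * φ₀) • A + Matrix.diagonal t₀)
    (h₁ : M₁ + M₀ * A = (2 * φ₁) • A + (Matrix.diagonal t₁ + A * Matrix.diagonal t₀))
    (h₂ : M₁ * A = (2 * φ₂) • A + A * Matrix.diagonal t₁)
    (h₃ : M = A * Matrix.diagonal t₀ + Matrix.diagonal κ)
    (h₄ : M * A = A * Matrix.diagonal t₁ + A * Matrix.diagonal κ)
    (hinj : Function.Injective fun n : ℕ => φ₂ * n * (n - 1) + t₁ 0 * n + κ 0)
    (hsymb : ∀ (E : ℂ[X] →ₗ[ℂ] ℂ[X]), IsScalarDiffOp E → ∀ (q : ℕ → ℂ[X]) (e : ℕ → ℂ),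
      (∀ n, X ^ n - q n ∈ degreeLT ℂ n) → (∀ n, E (q n) = e n • q n) →
      (∀ n, (E (X ^ n)).coeff n = e n) →
      (∀ n : ℕ, (C φ₀ + C φ₁ * X + C φ₂ * X ^ 2) * derivative (derivative (q n)) +
        (C (t₀ 0) + C (t₁ 0) * X) * derivative (q n) + C (κ 0) * q n
        = (φ₂ * n * (n - 1) + t₁ 0 * n + κ 0) • q n) →
      ∃ P : ℂ[X], ∀ n : ℕ, e n = P.eval (φ₂ * n * (n - 1) + t₁ 0 * n + κ 0)) :
    IsPolynomialAlgebraIn (weightAlgebra S W) (secondOrder φ₀ φ₁ φ₂ M₀ M₁ M) :=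
  h.isPolynomialAlgebraIn hW (secondOrder_mem_matDiffOps φ₀ φ₁ φ₂ M₀ M₁ M)
    (hat_conjOp_secondOrder h.sq_eq_zero h₀ h₁ h₂ h₃ h₄) (hat_secondOrder_mem φ₀ φ₁ φ₂ M₀ M₁ M) _
    (coeff_secondOrder_X_pow φ₀ φ₁ φ₂ (t₀ 0) (t₁ 0) (κ 0)) hinj hsymb

/-- When the eigenvalues are affine in the degree, every symbol is a polynomial in them. -/
theorem exists_eval_of_affine {E : ℂ[X] →ₗ[ℂ] ℂ[X]} (hE : IsScalarDiffOp E) {e : ℕ → ℂ}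
    (he : ∀ n, (E (X ^ n)).coeff n = e n) {t κ : ℂ} (ht : t ≠ 0) :
    ∃ P : ℂ[X], ∀ n : ℕ, e n = P.eval (0 * (n : ℂ) * (n - 1) + t * n + κ) := by
  obtain ⟨f, hf⟩ := hE.exists_symbol
  refine ⟨f.comp (C t⁻¹ * (X - C κ)), fun n => ?_⟩
  rw [← he, hf, eval_comp, eval_mul, eval_C, eval_sub, eval_X, eval_C]
  congr 1
  field_simp
  ring

theorem injective_affine {t κ : ℂ} (ht : t ≠ 0) :
    Function.Injective fun n : ℕ => 0 * (n : ℂ) * (n - 1) + t * n + κ := fun m n h => by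
  simpa [ht] using h

omit [NeZero N] in
theorem C_neg_mul (B : Mat N) (F : MatPoly N) : C (-B) * F = -(C B * F) :=
  eq_neg_of_add_eq_zero_left (by
    rw [← add_mul, ← C_add, show -B + B = 0 from neg_add_cancel B, C_0, zero_mul])

omit [NeZero N] in
theorem comm_matA_mul_matA (a : ℕ → ℝ) (d : Fin N → ℂ) :
    comm (matA N a) (Matrix.diagonal d) * matA N a = 0 := by
  rw [comm, sub_mul, matA_mul_diagonal_mul_matA, mul_assoc, matA_mul_matA, mul_zero, sub_zero]

omit [NeZero N] in
theorem isTwistSystem_matA {a : ℕ → ℝ} (ha : ∀ k, 1 ≤ k → k < N → a k ≠ 0)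
    {S : Set ℝ} (hS : MeasurableSet S) (hS0 : volume S ≠ 0) {w : Fin N → ℝ → ℝ}
    (hm : ∀ i, HasMoments S (w i)) (hw : ∀ i, ∀ x ∈ S, 0 < w i x) {φ : ℂ[X]} {τ : Fin N → ℂ[X]}
    (hP : ∀ i, IsPearson (moment (hm i)) φ (τ i)) (hφ : φ ≠ 0)
    (hrat : ∀ i j, i ≠ j → ∀ g h,
      φ * (derivative g * h - g * derivative h) = (τ j - τ i) * (g * h) → g = 0 ∨ h = 0) :
    IsTwistSystem (matA N a) (fun i => moment (hm i)) φ τ where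
  mul_eq_zero := matA_mul_matA_apply a
  real := matA_real a
  linked := matA_linked ha
  pos i := isPositiveMoment_moment (hm i) hS hS0 (hw i)
  pearson := hP
  phi_ne_zero := hφ
  not_rational := hrat

/-! ### Hermite weights -/

omit [NeZero N] in
theorem opH_eq (a : ℕ → ℝ) (b : Fin N → ℝ) :
    opH a b = secondOrder 1 0 0 (2 * matA N a + matBH b)
      ((-2 : ℂ) • 1 + comm (matA N a) (matBH b)) (matA N a * matBH b + 2 * matK N) := by
  have h : C ((-2 : ℂ) • (1 : Mat N)) * X = -(2 * X : MatPoly N) := by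
    rw [neg_smul, C_neg_mul, two_smul, C_add, C_1, add_mul, one_mul, two_mul]
  rw [opH, secondOrder, one_smul, zero_smul, C_0, C_1, zero_mul, zero_mul, add_zero, add_zero,
    coeffOp_one, mul_one, C_add (a := (-2 : ℂ) • (1 : Mat N)), add_mul, h, X_mul, sub_eq_add_neg,
    add_assoc (C _)]

theorem isPolynomialAlgebraIn_opH {a : ℕ → ℝ} (ha : ∀ k, 1 ≤ k → k < N → a k ≠ 0)
    {b : Fin N → ℝ} (hb : ∀ i j, i ≠ j → b i ≠ b j) :
    IsPolynomialAlgebraIn (weightAlgebra Set.univ (weightH a b)) (opH a b) := by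
  have hφ : (C 1 + C 0 * X + C 0 * X ^ 2 : ℂ[X]) = 1 := by simp
  have hsys : IsTwistSystem (matA N a) (fun i => moment (hasMoments_hermite (b i)))
      (C 1 + C 0 * X + C 0 * X ^ 2) (fun j => C (2 * (b j : ℂ)) + C (-2) * X) := by
    rw [hφ]
    refine isTwistSystem_matA ha .univ (by simp) _ (fun i x _ => Real.exp_pos _)
      (fun i => isPearson_hermite (b i)) one_ne_zero fun i j hij g h hgh => ?_
    refine eq_zero_or_eq_zero_of_derivative_eq (c := 2 * (b j : ℂ) - 2 * (b i : ℂ)) ?_ ?_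
    · rw [← mul_sub, ← Complex.ofReal_sub]
      simpa [sub_eq_zero] using hb j i hij.symm
    · rw [one_mul] at hgh
      rw [hgh, C_sub]
      ring
  have h2A : ∀ B : Mat N, 2 * B = (2 : ℂ) • B := fun B => by rw [two_mul, two_smul]
  have hK : Matrix.diagonal (fun i : Fin N => (2 : ℂ) * if Odd i.val then 1 else 0) =
      (2 : ℂ) • matK N := by
    rw [matK, ← Matrix.diagonal_smul]; rfl
  have h2 : Matrix.diagonal (fun _ : Fin N => (-2 : ℂ)) = (-2 : ℂ) • (1 : Mat N) :=
    (Matrix.smul_one_eq_diagonal _).symm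
  have hAA := matA_mul_matA (N := N) a
  have hABA : matA N a * matBH b * matA N a = 0 := matA_mul_diagonal_mul_matA a _
  rw [opH_eq]
  refine hsys.isPolynomialAlgebraIn_secondOrder
    -- The eigenvalue at degree `n` is `-2n + κ`; the extra `2` at odd indices offsets the degree
    -- shift by one along `A`.
    (κ := fun i : Fin N => (2 : ℂ) * if Odd i.val then 1 else 0)
    (matInner_twistedWeight a fun i => hasMoments_hermite (b i)) ?_ ?_ ?_ ?_ ?_ ?_ ?_
  · rw [h2A, mul_one]; rfl
  · rw [h2, h2A, add_mul, smul_mul_assoc, hAA, smul_zero, zero_add, mul_zero, zero_smul, zero_add,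
      comm, add_assoc, sub_add_cancel]; rfl
  · rw [h2, add_mul, matBH, comm_matA_mul_matA, mul_zero, zero_smul, smul_mul_assoc, one_mul,
      mul_smul_comm, mul_one, add_zero, zero_add]
  · rw [hK, h2A]; rfl
  · rw [hK, h2A, h2, add_mul, hABA, smul_mul_assoc, matK_mul_matA, mul_smul_comm, mul_smul_comm,
      mul_one, matA_mul_matK, smul_zero, zero_add, ← add_smul]
    simp
  · exact injective_affine (by norm_num)
  · exact fun E hE q e _ _ he _ => exists_eval_of_affine hE he (by norm_num)

/-! ### Laguerre weights -/

omit [NeZero N] in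
theorem opL_eq (a : ℕ → ℝ) (α : Fin N → ℝ) :
    opL a α = secondOrder 0 1 0 (matBL α)
      (-1 + 2 * matA N a + comm (matA N a) (matBL α)) (matA N a * matBL α + matK N) := by
  have h : C (-1 : Mat N) * X = -(X : MatPoly N) := by
    rw [C_neg_mul, C_1, one_mul]
  rw [opL, secondOrder, one_smul, zero_smul, C_0, C_1, one_mul, zero_mul, add_zero, zero_add,
    C_add (a := -1 + 2 * matA N a), C_add (a := (-1 : Mat N)), add_mul, add_mul, h, X_mul, X_mul,
    sub_eq_add_neg, add_assoc (C _), add_assoc (C _), add_assoc]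

theorem isPolynomialAlgebraIn_opL {a : ℕ → ℝ} (ha : ∀ k, 1 ≤ k → k < N → a k ≠ 0)
    {α : Fin N → ℝ} (hα : ∀ i, -1 < α i) (hαα : ∀ i j, i ≠ j → ∀ n : ℤ, α i - α j ≠ n) :
    IsPolynomialAlgebraIn (weightAlgebra (Set.Ioi 0) (weightL a α)) (opL a α) := by
  have hφ : (C 0 + C 1 * X + C 0 * X ^ 2 : ℂ[X]) = X := by simp
  have hsys : IsTwistSystem (matA N a) (fun i => moment (hasMoments_laguerre (hα i)))
      (C 0 + C 1 * X + C 0 * X ^ 2) (fun j => C ((α j : ℂ) + 1) + C (-1) * X) := by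
    rw [hφ]
    refine isTwistSystem_matA ha measurableSet_Ioi (by simp) _
      (fun i x hx => mul_pos (Real.exp_pos _) (Real.rpow_pos_of_pos hx _))
      (fun i => isPearson_laguerre (hα i)) X_ne_zero fun i j hij g h hgh => ?_
    -- The residue at `0` is `α j - α i`.
    refine eq_zero_or_eq_zero_of_root (r := 0) (ψ := 1) (fun n hn => ?_)
      (by rw [C_0, sub_zero, mul_one]; exact hgh)
    simp only [eval_one, one_mul, eval_sub, eval_C, add_sub_add_right_eq_sub] at hn
    exact hαα j i hij.symm n (by exact_mod_cast hn.symm)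
  have h2A : ∀ B : Mat N, 2 * B = (2 : ℂ) • B := fun B => by rw [two_mul, two_smul]
  have h2 : Matrix.diagonal (fun _ : Fin N => (-1 : ℂ)) = (-1 : Mat N) := by
    rw [← Matrix.smul_one_eq_diagonal, neg_smul, one_smul]
  have hAA := matA_mul_matA (N := N) a
  have hABA : matA N a * matBL α * matA N a = 0 := matA_mul_diagonal_mul_matA a _
  rw [opL_eq]
  refine hsys.isPolynomialAlgebraIn_secondOrder
    (κ := fun i : Fin N => if Odd i.val then 1 else 0)
    (matInner_twistedWeight a fun i => hasMoments_laguerre (hα i)) ?_ ?_ ?_ ?_ ?_ ?_ ?_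
  · rw [mul_zero, zero_smul, zero_add]; rfl
  · rw [h2, h2A, mul_one, comm, add_assoc, sub_add_cancel, add_comm (-1 : Mat N), add_assoc]; rfl
  · rw [h2, add_mul, matBL, comm_matA_mul_matA, mul_zero, zero_smul, add_mul, h2A, smul_mul_assoc,
      hAA, smul_zero, neg_one_mul, mul_neg_one, add_zero, zero_add, add_zero]
  · rfl
  · rw [h2, add_mul, hABA, matK_mul_matA, mul_neg_one, zero_add]
    change 0 = -matA N a + matA N a * matK N
    rw [matA_mul_matK, neg_add_cancel]
  · exact injective_affine (by norm_num)
  · exact fun E hE q e _ _ he _ => exists_eval_of_affine hE he (by norm_num)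

/-! ### Jacobi weights -/

theorem opJ_eq (a : ℕ → ℝ) (α β : Fin N → ℝ) :
    opJ a α β = secondOrder 1 0 (-1) (2 * matA N a + matBJ α β)
      (comm (matA N a) (matBJ α β) + 2 * matK N - ((α 0 : ℂ) + (β 0 : ℂ) + 2) • (1 : Mat N))
      (matA N a * matBJ α β + ((α 0 : ℂ) + (β 0 : ℂ)) • matK N) := by
  have h : C ((-1 : ℂ) • (1 : Mat N)) * X ^ 2 = -(X ^ 2 : MatPoly N) := by
    rw [neg_smul, C_neg_mul, one_smul, C_1, one_mul]
  rw [opJ, secondOrder, one_smul, zero_smul, C_0, C_1, zero_mul, add_zero, h, X_mul, sub_eq_add_neg]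

omit [NeZero N] in
-- The sums `α j + β j` differ by integers, so a non-integral difference of the `α`'s forces one of
-- the `β`'s. The single endpoint `-1` then suffices.
theorem not_int_of_jacobi {α β : Fin N → ℝ} {s : ℝ}
    (hab : ∀ i j, i ≠ j → (∀ n : ℤ, α i - α j ≠ n) ∨ (∀ n : ℤ, β i - β j ≠ n))
    (hs : ∀ j : Fin N, s = α j + β j + 1 + (-1) ^ (j.val + 1)) {i j : Fin N} (hij : i ≠ j) (n : ℤ) :
    β i - β j ≠ n := by
  rcases hab i j hij with h | h
  · intro hn
    refine h ((-1) ^ (j.val + 1) - (-1) ^ (i.val + 1) - n) ?_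
    push_cast
    linarith [hs i, hs j]
  · exact h n

theorem isPolynomialAlgebraIn_opJ {a : ℕ → ℝ} (ha : ∀ k, 1 ≤ k → k < N → a k ≠ 0)
    {α β : Fin N → ℝ} (hα : ∀ i, -1 < α i) (hβ : ∀ i, -1 < β i)
    (hab : ∀ i j, i ≠ j → (∀ n : ℤ, α i - α j ≠ n) ∨ (∀ n : ℤ, β i - β j ≠ n))
    (hs : ∀ j : Fin N, α 0 + β 0 = α j + β j + 1 + (-1) ^ (j.val + 1)) :
    IsPolynomialAlgebraIn (weightAlgebra (Set.Ioo (-1) 1) (weightJ a α β)) (opJ a α β) := by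
  have hφ : (C 1 + C 0 * X + C (-1) * X ^ 2 : ℂ[X]) = 1 - X ^ 2 := by
    simp [sub_eq_add_neg]
  have hφ0 : (1 - X ^ 2 : ℂ[X]) ≠ 0 := fun h0 => by
    simpa using congrArg (eval 0) h0
  have hsys : IsTwistSystem (matA N a) (fun i => moment (hasMoments_jacobi (hα i) (hβ i)))
      (C 1 + C 0 * X + C (-1) * X ^ 2)
      (fun j => C ((β j : ℂ) - α j) + C (-((α j : ℂ) + β j + 2)) * X) := by
    rw [hφ]
    refine isTwistSystem_matA ha measurableSet_Ioo (by simp) _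
      (fun i x hx => mul_pos (Real.rpow_pos_of_pos (by linarith [hx.2]) _)
        (Real.rpow_pos_of_pos (by linarith [hx.1]) _))
      (fun i => isPearson_jacobi (hα i) (hβ i)) hφ0 fun i j hij g h hgh => ?_
    -- Here `ψ(-1) = 2` and `(τ j - τ i)(-1) = 2 (β j - β i)`, so the residue is `β j - β i`.
    refine eq_zero_or_eq_zero_of_root (r := -1) (ψ := 1 - X) (fun n hn => ?_)
      (by rw [← hgh, C_neg, C_1]; ring)
    simp only [eval_one, eval_sub, eval_add, eval_C, eval_mul, eval_X] at hn
    refine not_int_of_jacobi hab hs hij.symm n ?_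
    have : (β j : ℂ) - β i = n := by linear_combination -(1 / 2) * hn
    exact_mod_cast this
  have h2A : ∀ B : Mat N, 2 * B = (2 : ℂ) • B := fun B => by rw [two_mul, two_smul]
  have hK : Matrix.diagonal (fun i : Fin N => ((α 0 : ℂ) + β 0) * if Odd i.val then 1 else 0) =
      ((α 0 : ℂ) + β 0) • matK N := by
    rw [matK, ← Matrix.diagonal_smul]; rfl
  -- The constraint on the sums `α j + β j` enters the conjugation here: they equal `α 0 + β 0` at
  -- even indices and are smaller by `2` at odd ones.
  have ht : Matrix.diagonal (fun j : Fin N => -((α j : ℂ) + β j + 2)) =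
      (2 : ℂ) • matK N + (-((α 0 : ℂ) + β 0 + 2)) • (1 : Mat N) := by
    rw [matK, ← Matrix.diagonal_smul, Matrix.smul_one_eq_diagonal, Matrix.diagonal_add]
    congr 1
    ext j
    have hj : (α 0 : ℂ) + β 0 = α j + β j + 1 + (-1) ^ (j.val + 1) := by exact_mod_cast hs j
    simp only [Pi.smul_apply, smul_eq_mul]
    rw [hj]
    split_ifs with ho
    · rw [ho.add_one.neg_one_pow]; ring
    · rw [(Nat.not_odd_iff_even.1 ho).add_one.neg_one_pow]; ring
  have hAA := matA_mul_matA (N := N) a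
  have hABA : matA N a * matBJ α β * matA N a = 0 := matA_mul_diagonal_mul_matA a _
  have hAK := matA_mul_matK (N := N) a
  have hKA := matK_mul_matA (N := N) a
  have hα0 := hα 0
  have hβ0 := hβ 0
  rw [opJ_eq]
  refine hsys.isPolynomialAlgebraIn_secondOrder
    (κ := fun i : Fin N => ((α 0 : ℂ) + β 0) * if Odd i.val then 1 else 0)
    (matInner_twistedWeight a fun i => hasMoments_jacobi (hα i) (hβ i)) ?_ ?_ ?_ ?_ ?_ ?_ ?_
  · rw [h2A, mul_one]; rfl
  · change _ = _ + (_ + matA N a * matBJ α β)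
    rw [ht, h2A, h2A, add_mul, smul_mul_assoc, hAA, comm, mul_zero, zero_smul, smul_zero, neg_smul]
    abel
  · rw [ht, h2A, sub_mul, add_mul, matBJ, comm_matA_mul_matA, mul_add, mul_smul_comm, hAK,
      mul_smul_comm, mul_one, smul_mul_assoc, hKA, smul_mul_assoc, one_mul, neg_smul]
    module
  · rw [hK]; rfl
  · rw [hK, ht, add_mul, hABA, smul_mul_assoc, hKA, mul_add, mul_smul_comm, mul_smul_comm,
      mul_smul_comm, mul_one, hAK]
    module
  -- The eigenvalue is `-n (n + α 0 + β 0 + 1)`. A coincidence for `m ≠ n` needs `m + n + α 0 + β 0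
  -- + 1 = 0`, impossible since `m + n ≥ 1` and `α 0 + β 0 > -2`.
  · intro m n hmn
    by_contra hne
    have h1 : ((m : ℝ) - n) * (m + n + (α 0 + β 0 + 1)) = 0 := by
      have : ((m : ℂ) - n) * (m + n + (α 0 + β 0 + 1)) = 0 := by
        simp only at hmn
        linear_combination -hmn
      exact_mod_cast this
    rcases mul_eq_zero.1 h1 with h2 | h2
    · exact hne (by exact_mod_cast sub_eq_zero.1 h2)
    · have h3 : 1 ≤ m + n := by omega
      have h4 : (1 : ℝ) ≤ m + n := by exact_mod_cast h3
      linarith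
  · intro E hE q e hq hEq _ hl
    refine exists_eval_eigenvalue_of_jacobi hE (t₀ := (β 0 : ℂ) - α 0)
      (t₁ := -((α 0 : ℂ) + β 0 + 2)) (fun k hk => ?_) (fun n => ne_zero_of_X_pow_sub_mem (hq n))
      hEq fun n => ?_
    -- The recursion divides by `2 (β 0 + 1 + k)`, positive because `β 0 > -1`.
    · have h1 : (β 0 : ℝ) - α 0 + (α 0 + β 0 + 2) + 2 * k = 0 := by
        have : (β 0 : ℂ) - α 0 + (α 0 + β 0 + 2) + 2 * k = 0 := by linear_combination hk
        exact_mod_cast this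
      have : (0 : ℝ) ≤ k := k.cast_nonneg
      linarith
    · have := hl n
      have hκ : ((α 0 : ℂ) + β 0) * (if Odd ((0 : Fin N) : ℕ) then 1 else 0) = 0 := by simp
      rw [hφ, hκ, C_0, zero_mul, add_zero, smul_eq_C_mul] at this
      rw [hκ]
      exact this

end final

end MatrixBochner

end

theorem mainTheorem2 (N : ℕ) [NeZero N] (a : ℕ → ℝ) (ha : ∀ k, 1 ≤ k → k < N → a k ≠ 0) :
    -- Hermite type
    (∀ b : Fin N → ℝ, (∀ i j, i ≠ j → b i ≠ b j) →
      MatrixBochner.IsPolynomialAlgebraIn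
        (MatrixBochner.weightAlgebra Set.univ (MatrixBochner.weightH a b))
        (MatrixBochner.opH a b)) ∧
    -- Laguerre type
    (∀ α : Fin N → ℝ, (∀ i, -1 < α i) → (∀ i j, i ≠ j → ∀ n : ℤ, α i - α j ≠ n) →
      MatrixBochner.IsPolynomialAlgebraIn
        (MatrixBochner.weightAlgebra (Set.Ioi 0) (MatrixBochner.weightL a α))
        (MatrixBochner.opL a α)) ∧
    -- Jacobi type
    (∀ α β : Fin N → ℝ, (∀ i, -1 < α i) → (∀ i, -1 < β i) →
      (∀ i j, i ≠ j → (∀ n : ℤ, α i - α j ≠ n) ∨ (∀ n : ℤ, β i - β j ≠ n)) →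
      (∀ j : Fin N, α 0 + β 0 = α j + β j + 1 + (-1) ^ (j.val + 1)) →
      MatrixBochner.IsPolynomialAlgebraIn
        (MatrixBochner.weightAlgebra (Set.Ioo (-1) 1) (MatrixBochner.weightJ a α β))
        (MatrixBochner.opJ a α β)) :=
  ⟨fun _ hb => MatrixBochner.isPolynomialAlgebraIn_opH ha hb,
    fun _ hα hαα => MatrixBochner.isPolynomialAlgebraIn_opL ha hα hαα,
    fun _ _ hα hβ hab hs => MatrixBochner.isPolynomialAlgebraIn_opJ ha hα hβ hab hs⟩
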